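/- A turn-based stochastic Rabin game $G=(S,S_s,S_e,I,A,T,W)$ consists of finite sets $S$ of states and $A$ of actions, a partition $S=S_s\sqcup S_e$ into system and environment states, initial states $I\subseteq S$, nonempty sets $A^G(s)\subseteq A$ of available actions, transition distributions $T(s,a)\in\mathcal D(S)$, and Rabin pairs $W=\{(E_1,F_1),\dots,(E_d,F_d)\}$ with $E_i\cap F_i=\emptyset$. A run is winning if for some $i$ it visits $F_i$ infinitely often and every state of $E_i$ only finitely often. A (randomized) strategy of a player has a countable set $M$ of memory states, an initial memory state $m^0$, an update function $S\times M\to M$ and, for each state of the player and each memory state, a distribution on the available actions; it is memoryless if $|M|=1$. A system strategy is almost-sure winning if, from every $s\in I$ and against every environment strategy, the run is winning with probability $1$. Let $\mathcal R:S\times A\times S\to[0,R_{\max}]$ be a reward function and $\gamma\in(0,1)$ a discount factor. Let $V_G(s,\sigma_s,\sigma_e)$ be the expectation of $\sum_{t\ge0}\gamma^t\mathcal R(s^t,a^{t+1},s^{t+1})$ over the runs from $s$ under $(\sigma_s,\sigma_e)$, $\tilde V_G(s,\sigma_s)=\inf_{\sigma_e}V_G(s,\sigma_s,\sigma_e)$,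 and $V^*(s)=\sup_{\sigma_s}\tilde V_G(s,\sigma_s)$. The strategy $\sigma_s$ is $\varepsilon$-optimal if $\tilde V_G(s,\sigma_s)\ge V^*(s)-\varepsilon$ for all $s\in S$. The optimal actions at $s$ are $A^*(s)=\arg\max_{a\in A^G(s)}\sum_{s'}T(s,a)(s')\big(\mathcal R(s,a,s')+\gamma V^*(s')\big)$. Let $\varepsilon>0$ with $\varepsilon(1-\gamma)\le R_{\max}$; equivalently, $p:=\frac{(1-\gamma)^2\varepsilon}{R_{\max}-\varepsilon(1-\gamma)\gamma}$ lies in $(0,1]$. The game $\hat G$ is obtained from $G$ by adding, for each $s\in S_s$, two new system states $N(s)$ and $O(s)$, and a new action $\hat a$. At $s\in S_s$ the only available action is $\hat a$, which leads to $N(s)$ with probability $p$ and to $O(s)$ with probability $1-p$. The available actions are $A^G(s)$ at $N(s)$ and $A^*(s)$ at $O(s)$, and an action $a$ leads from either state to $s'\in S$ with probability $T(s,a)(s')$. Environment states, initial states and Rabin pairs are unchanged. **Lemma.** For every such $G$ and every memoryless system strategy $\hat\sigma_s$ in $\hat G$, the formula $$\sigma_s(s)(a)=\begin{cases}p\,\hat\sigma_s(N(s))(a)+(1-p)\,\hat\sigma_s(O(s))(a)&\text{if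 }a\in A^*(s),\\ p\,\hat\sigma_s(N(s))(a)&\text{if }a\in A^G(s)\setminus A^*(s),\end{cases}\qquad s\in S_s,$$ defines a memoryless system strategy $\sigma_s$ in $G$ such that 1. $\sigma_s$ is $\varepsilon$-optimal in $G$; and 2. $\hat\sigma_s$ is almost-sure winning for the system in $\hat G$ if and only if $\sigma_s$ is almost-sure winning for the system in $G$. -/

import Mathlib

open MeasureTheory ProbabilityTheory Filter

noncomputable section

/-- A turn-based stochastic Rabin game with finite state space `S` and finite set of actions `A`.
`sys` is the set of system states (all other states belong to the environment), `init` the set of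
initial states, `act s` the nonempty set of actions available at `s`, `T` the transition function
(its values at unavailable actions are never used), and `(E i, F i)`, `i : Fin d`, are the Rabin
pairs. -/
structure RabinGame (S A : Type*) [Finite S] [Finite A] where
  sys : Set S
  init : Set S
  act : S → Set A
  act_nonempty : ∀ s, (act s).Nonempty
  T : S → A → PMF S
  d : ℕ
  E : Fin d → Set S
  F : Fin d → Set S
  disjoint_pairs : ∀ i, E i ∩ F i = ∅

/-- A step `(state, action)` of a run. -/
def Step (S A : Type*) : Type _ := S × A

instance {S A : Type*} [Finite S] [Finite A] : Finite (Step S A) :=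
  inferInstanceAs (Finite (S × A))

/-- The set of steps is finite and carries the discrete σ-algebra; runs carry the product
σ-algebra. -/
instance {S A : Type*} : MeasurableSpace (Step S A) := ⊤

instance {S A : Type*} : DiscreteMeasurableSpace (Step S A) := ⟨fun _ => trivial⟩

/-- Infinite sequences of state-action pairs; the `n`-th entry is the `n`-th state together with
the action taken there. -/
abbrev Run (S A : Type*) := ℕ → Step S A

namespace RabinGame

variable {S A : Type*} [Finite S] [Finite A]

/-- A randomized strategy, with a countable set of memory states, for the player that owns the
states in `P`. -/
structure Strategy (G : RabinGame S A) (P : Set S) where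
  Mem : Type
  countable_mem : Countable Mem
  init : Mem
  update : S → Mem → Mem
  choice : P → Mem → PMF A
  choice_available : ∀ s m, (choice s m).support ⊆ G.act s

/-- Strategies of the system. -/
abbrev SysStrategy (G : RabinGame S A) := G.Strategy G.sys

/-- Strategies of the environment. -/
abbrev EnvStrategy (G : RabinGame S A) := G.Strategy G.sysᶜ

namespace Strategy

variable {G : RabinGame S A} {P : Set S}

/-- A strategy is memoryless if its set of memory states is a singleton. -/
def Memoryless (σ : G.Strategy P) : Prop := ∃ m : σ.Mem, ∀ m', m' = m

/-- The sequence of memory states along a sequence of states. -/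
def memory (σ : G.Strategy P) (x : ℕ → S) : ℕ → σ.Mem
  | 0 => σ.init
  | n + 1 => σ.update (x n) (memory σ x n)

end Strategy

variable (G : RabinGame S A)

open Classical in
/-- The distribution of the next action at state `s`, for memory states `m` of the system and `k`
of the environment. -/
def actionDist (σ : G.SysStrategy) (τ : G.EnvStrategy) (s : S) (m : σ.Mem) (k : τ.Mem) : PMF A :=
  if h : s ∈ G.sys then σ.choice ⟨s, h⟩ m else τ.choice ⟨s, h⟩ k

/-- The states of a finite history of steps `0, …, n`, continued constantly. -/
def historyState {n : ℕ} (h : Finset.Iic n → Step S A) (i : ℕ) : S :=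
  (h ⟨min i n, Finset.mem_Iic.2 (min_le_right i n)⟩).1

/-- The distribution of step `n + 1` after the history `h` of steps `0, …, n`. -/
def stepDist (σ : G.SysStrategy) (τ : G.EnvStrategy) (n : ℕ) (h : Finset.Iic n → Step S A) :
    PMF (Step S A) :=
  let last := h ⟨n, Finset.mem_Iic.2 le_rfl⟩
  (G.T last.1 last.2).bind fun s' =>
    (G.actionDist σ τ s' (σ.memory (historyState h) (n + 1))
      (τ.memory (historyState h) (n + 1))).map fun a' => (s', a')

/-- `stepDist` as a Markov kernel. -/
def stepKernel (σ : G.SysStrategy) (τ : G.EnvStrategy) (n : ℕ) :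
    Kernel (Finset.Iic n → Step S A) (Step S A) :=
  Kernel.ofFunOfCountable fun h => (G.stepDist σ τ n h).toMeasure

instance (σ : G.SysStrategy) (τ : G.EnvStrategy) (n : ℕ) :
    IsMarkovKernel (G.stepKernel σ τ n) :=
  ⟨fun h => inferInstanceAs (IsProbabilityMeasure (G.stepDist σ τ n h).toMeasure)⟩

/-- The distribution of step `0` of a run starting at `s₀`. -/
def startDist (σ : G.SysStrategy) (τ : G.EnvStrategy) (s₀ : S) : PMF (Step S A) :=
  (G.actionDist σ τ s₀ σ.init τ.init).map fun a => (s₀, a)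

/-- The probability measure on runs that start at `s₀`, induced by a pair of strategies. -/
def runMeasure (s₀ : S) (σ : G.SysStrategy) (τ : G.EnvStrategy) : Measure (Run S A) :=
  Kernel.trajMeasure (X := fun _ => Step S A) (G.startDist σ τ s₀).toMeasure (G.stepKernel σ τ)

/-- The states visited infinitely often. -/
def infSet (π : Run S A) : Set S := {s | ∃ᶠ n in atTop, (π n).1 = s}

/-- The Rabin condition. -/
def Winning (π : Run S A) : Prop :=
  ∃ i : Fin G.d, (infSet π ∩ G.F i).Nonempty ∧ infSet π ∩ G.E i = ∅

/-- A system strategy is almost-sure winning if, from every initial state and against every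
environment strategy, the run is winning with probability one. -/
def AlmostSureWinning (σ : G.SysStrategy) : Prop :=
  ∀ s ∈ G.init, ∀ τ : G.EnvStrategy, ∀ᵐ π ∂(G.runMeasure s σ τ), G.Winning π

/-- The discounted reward of a run. -/
def discountedReward (R : S → A → S → ℝ) (γ : ℝ) (π : Run S A) : ℝ :=
  ∑' t : ℕ, γ ^ t * R (π t).1 (π t).2 (π (t + 1)).1

/-- The expected discounted reward from `s` under a pair of strategies. -/
def value (R : S → A → S → ℝ) (γ : ℝ) (s : S) (σ : G.SysStrategy) (τ : G.EnvStrategy) : ℝ :=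
  ∫ π, discountedReward R γ π ∂(G.runMeasure s σ τ)

/-- The value of a system strategy: its worst-case expected discounted reward. -/
def strategyValue (R : S → A → S → ℝ) (γ : ℝ) (s : S) (σ : G.SysStrategy) : ℝ :=
  ⨅ τ : G.EnvStrategy, G.value R γ s σ τ

/-- The optimal value over all system strategies. -/
def optValue (R : S → A → S → ℝ) (γ : ℝ) (s : S) : ℝ :=
  ⨆ σ : G.SysStrategy, G.strategyValue R γ s σ

/-- A system strategy is `ε`-optimal if, from every state, its value is at least the optimal value
minus `ε`. -/
def EpsOptimal (R : S → A → S → ℝ) (γ ε : ℝ) (σ : G.SysStrategy) : Prop :=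
  ∀ s, G.strategyValue R γ s σ ≥ G.optValue R γ s - ε

/-- The expected one-step reward plus discounted optimal value, when `a` is taken at `s`
(a finite sum, as `S` is finite). -/
def qValue (R : S → A → S → ℝ) (γ : ℝ) (s : S) (a : A) : ℝ :=
  ∑' s', (G.T s a s').toReal * (R s a s' + γ * G.optValue R γ s')

/-- The optimal actions at `s`: the maximizers of `qValue` among the available actions. -/
def optAct (R : S → A → S → ℝ) (γ : ℝ) (s : S) : Set A :=
  {a | a ∈ G.act s ∧ ∀ a' ∈ G.act s, G.qValue R γ s a' ≤ G.qValue R γ s a}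

theorem optAct_nonempty (R : S → A → S → ℝ) (γ : ℝ) (s : S) : (G.optAct R γ s).Nonempty := by
  obtain ⟨a, ha, hmax⟩ :=
    (G.act s).exists_max_image (G.qValue R γ s) (Set.toFinite _) (G.act_nonempty s)
  exact ⟨a, ha, hmax⟩

/-! ### The game with split system states -/

/-- States of the split game: the original states, a copy `freeState s` and a copy `optState s` of
each system state `s`. -/
abbrev HatState : Type _ := S ⊕ (G.sys ⊕ G.sys)

/-- The copy of `s` at which all actions available at `s` may be taken. -/
def freeState (s : G.sys) : G.HatState := Sum.inr (Sum.inl s)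

/-- The copy of `s` at which only the optimal actions at `s` may be taken. -/
def optState (s : G.sys) : G.HatState := Sum.inr (Sum.inr s)

/-- System states of the split game: the original ones and all copies. -/
def hatSys : Set G.HatState := {x | ∀ s, x = Sum.inl s → s ∈ G.sys}

theorem freeState_mem (s : G.sys) : G.freeState s ∈ G.hatSys := by
  intro t h
  cases h

theorem optState_mem (s : G.sys) : G.optState s ∈ G.hatSys := by
  intro t h
  cases h

open Classical in
/-- Available actions of the split game; `none` is the new action, `some a` is the action `a`. -/
def hatAct (R : S → A → S → ℝ) (γ : ℝ) : G.HatState → Set (Option A)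
  | Sum.inl s => if s ∈ G.sys then {none} else some '' G.act s
  | Sum.inr (Sum.inl s) => some '' G.act s
  | Sum.inr (Sum.inr s) => some '' G.optAct R γ s

theorem hatAct_nonempty (R : S → A → S → ℝ) (γ : ℝ) :
    ∀ x, (G.hatAct R γ x).Nonempty
  | Sum.inl s => by
    by_cases h : s ∈ G.sys
    · rw [hatAct, if_pos h]
      exact Set.singleton_nonempty _
    · rw [hatAct, if_neg h]
      exact (G.act_nonempty s).image _
  | Sum.inr (Sum.inl s) => (G.act_nonempty s).image _
  | Sum.inr (Sum.inr s) => (G.optAct_nonempty R γ s).image _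

/-- The distribution that gives `true` probability `p` and `false` probability `1 - p`. -/
def coin (p : ℝ) (hp : p ∈ Set.Icc (0 : ℝ) 1) : PMF Bool :=
  PMF.ofFintype (fun b => ENNReal.ofReal (if b then p else 1 - p)) (by
    simp only [Fintype.sum_bool, if_true, Bool.false_eq_true, if_false]
    rw [← ENNReal.ofReal_add hp.1 (sub_nonneg.2 hp.2)]
    simp)

/-- The transition `T s a` into the original states of the split game (the new action is
unavailable wherever this is used; a self-loop is put there). -/
def liftT (s : S) : Option A → PMF G.HatState
  | some a => (G.T s a).map Sum.inl
  | none => PMF.pure (Sum.inl s)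

open Classical in
/-- The transition function of the split game: from an original system state to its free copy with
probability `p` and to its optimal copy with probability `1 - p`; elsewhere as in `G`. -/
def hatT (p : ℝ) (hp : p ∈ Set.Icc (0 : ℝ) 1) : G.HatState → Option A → PMF G.HatState
  | Sum.inl s => fun a =>
      if h : s ∈ G.sys then
        (coin p hp).map fun b => if b then G.freeState ⟨s, h⟩ else G.optState ⟨s, h⟩
      else G.liftT s a
  | Sum.inr (Sum.inl s) => G.liftT s
  | Sum.inr (Sum.inr s) => G.liftT s

/-- The split game, with branching probability `p`. -/
def hat (R : S → A → S → ℝ) (γ p : ℝ) (hp : p ∈ Set.Icc (0 : ℝ) 1) :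
    RabinGame G.HatState (Option A) where
  sys := G.hatSys
  init := Sum.inl '' G.init
  act := G.hatAct R γ
  act_nonempty := G.hatAct_nonempty R γ
  T := G.hatT p hp
  d := G.d
  E i := Sum.inl '' G.E i
  F i := Sum.inl '' G.F i
  disjoint_pairs i := by
    rw [← Set.image_inter Sum.inl_injective, G.disjoint_pairs i, Set.image_empty]

end RabinGame

/-- The branching probability for tolerance `ε`, reward bound `Rmax` and discount factor `γ`. -/
def branchProb (Rmax γ ε : ℝ) : ℝ := (1 - γ) ^ 2 * ε / (Rmax - ε * (1 - γ) * γ)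

/-- The branching probability is positive and at most one exactly if `ε (1 - γ) ≤ Rmax`. -/
theorem branchProb_mem_Ioc_iff {Rmax γ ε : ℝ} (hγ1 : γ < 1) (hε : 0 < ε) :
    branchProb Rmax γ ε ∈ Set.Ioc (0 : ℝ) 1 ↔ ε * (1 - γ) ≤ Rmax := by
  have h1 : 0 < ε * (1 - γ) := mul_pos hε (sub_pos.2 hγ1)
  have hn : 0 < (1 - γ) ^ 2 * ε := mul_pos (pow_pos (sub_pos.2 hγ1) 2) hε
  have key : (1 - γ) ^ 2 * ε = ε * (1 - γ) - ε * (1 - γ) * γ := by ring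
  have h2 : ε * (1 - γ) * γ < ε * (1 - γ) := by nlinarith
  unfold branchProb
  constructor
  · rintro ⟨hpos, hle⟩
    have hd : 0 < Rmax - ε * (1 - γ) * γ := by
      by_contra hd
      exact absurd hpos (not_lt.2 (div_nonpos_of_nonneg_of_nonpos hn.le (not_lt.1 hd)))
    rw [div_le_one hd] at hle
    linarith
  · intro h
    have hd : 0 < Rmax - ε * (1 - γ) * γ := by linarith
    refine ⟨div_pos hn hd, ?_⟩
    rw [div_le_one hd]
    linarith

theorem branchProb_mem {Rmax γ ε : ℝ} (hγ1 : γ < 1) (hε : 0 < ε)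
    (h : ε * (1 - γ) ≤ Rmax) : branchProb Rmax γ ε ∈ Set.Icc (0 : ℝ) 1 :=
  Set.Ioc_subset_Icc_self ((branchProb_mem_Ioc_iff hγ1 hε).2 h)

end

open MeasureTheory ProbabilityTheory Filter

noncomputable section

/-! The two claims are independent of each other. For ε-optimality, let v be the optimal value. The
Shapley operator is a γ-contraction, and every fixed point of it is the optimal value
(`optValue_eq_of_isGreatest_of_isLeast`). Hence v solves the optimality equation: optimal system
actions and all available environment actions have one-step value at least v. A function f with f ≤
E[R + γ f] at every state and memory bounds the value from below, by telescoping (`le_value`). Under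
the mixed strategy f = max(0, v - ε) is such a function: the optimal component, of weight 1 - p,
yields at least v - γε, the free component at least 0, and (1 - p)(v - γε) ≥ v - ε means p v ≤ ε(1 -
γ + pγ). Since v ≤ Rmax/(1 - γ), it is enough that p Rmax/(1 - γ) = ε(1 - γ + pγ), and this equation
defines p.

For almost-sure winning, a memoryless system strategy leaves a Markov decision process to the
environment. By conditional Borel–Cantelli the steps recurring infinitely often almost surely form
an end component. Conversely, the environment enters any given reachable end component with positive
probability and then visits exactly its states infinitely often. So the strategy fails iff some
reachable end component has states violating the Rabin condition (`not_almostSureWinning_iff`),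
which depends on supports only. As p > 0, an action has positive probability in the mixture iff it
has at the free copy or, when p < 1, at the optimal copy; for p = 1 the optimal copy is never
entered. End components of the two games therefore correspond by inserting or contracting copies
(`isEndComponent_liftSteps`, `isEndComponent_descendSteps`). Original states are preserved, and only
these occur in Rabin pairs. -/

/-! ### Finite expectations -/

namespace PMF

variable {X Y : Type*}

/-- The expectation of a real function on a finite type. -/
def expect (p : PMF X) (f : X → ℝ) : ℝ := ∑' x, (p x).toReal * f x

theorem expect_eq_sum [Fintype X] (p : PMF X) (f : X → ℝ) :
    p.expect f = ∑ x, (p x).toReal * f x := tsum_fintype _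

theorem sum_toReal [Fintype X] (p : PMF X) : ∑ x, (p x).toReal = 1 := by
  rw [← ENNReal.toReal_sum fun x _ => p.apply_ne_top x, ← tsum_fintype (L := .unconditional _),
    p.tsum_coe, ENNReal.toReal_one]

variable [Finite X] [Finite Y]

theorem expect_const (p : PMF X) (c : ℝ) : (p.expect fun _ => c) = c := by
  cases nonempty_fintype X
  rw [expect_eq_sum, ← Finset.sum_mul, sum_toReal, one_mul]

theorem expect_mono {p : PMF X} {f g : X → ℝ} (h : ∀ x, p x ≠ 0 → f x ≤ g x) :
    p.expect f ≤ p.expect g := by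
  cases nonempty_fintype X
  simp only [expect_eq_sum]
  refine Finset.sum_le_sum fun x _ => ?_
  by_cases hx : p x = 0
  · simp [hx]
  · exact mul_le_mul_of_nonneg_left (h x hx) ENNReal.toReal_nonneg

theorem le_expect {p : PMF X} {f : X → ℝ} {c : ℝ} (h : ∀ x, p x ≠ 0 → c ≤ f x) :
    c ≤ p.expect f :=
  (expect_const p c).ge.trans (expect_mono h)

theorem expect_le {p : PMF X} {f : X → ℝ} {c : ℝ} (h : ∀ x, p x ≠ 0 → f x ≤ c) :
    p.expect f ≤ c :=
  (expect_mono h).trans (expect_const p c).le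

theorem expect_congr {p : PMF X} {f g : X → ℝ} (h : ∀ x, p x ≠ 0 → f x = g x) :
    p.expect f = p.expect g :=
  le_antisymm (expect_mono fun x hx => (h x hx).le) (expect_mono fun x hx => (h x hx).ge)

theorem expect_add (p : PMF X) (f g : X → ℝ) :
    (p.expect fun x => f x + g x) = p.expect f + p.expect g := by
  cases nonempty_fintype X
  simp only [expect_eq_sum, mul_add, Finset.sum_add_distrib]

theorem expect_const_mul (p : PMF X) (c : ℝ) (f : X → ℝ) :
    (p.expect fun x => c * f x) = c * p.expect f := by
  cases nonempty_fintype X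
  simp only [expect_eq_sum, Finset.mul_sum]
  exact Finset.sum_congr rfl fun x _ => by ring

open Classical in
theorem expect_single (p : PMF X) (x : X) :
    (p.expect fun y => if y = x then 1 else 0) = (p x).toReal := by
  cases nonempty_fintype X
  simp [expect_eq_sum]

theorem expect_pure (x : X) (f : X → ℝ) : (PMF.pure x).expect f = f x := by
  classical
  cases nonempty_fintype X
  rw [expect_eq_sum, Finset.sum_eq_single x]
  · simp
  · intro y _ hy
    simp [hy]
  · simp

theorem expect_bind (p : PMF X) (q : X → PMF Y) (f : Y → ℝ) :
    (p.bind q).expect f = p.expect fun x => (q x).expect f := by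
  cases nonempty_fintype X
  cases nonempty_fintype Y
  simp only [expect_eq_sum, Finset.mul_sum, bind_apply, tsum_fintype]
  rw [Finset.sum_comm]
  refine Finset.sum_congr rfl fun y _ => ?_
  rw [ENNReal.toReal_sum fun x _ => ENNReal.mul_ne_top (p.apply_ne_top x) ((q x).apply_ne_top y),
    Finset.sum_mul]
  exact Finset.sum_congr rfl fun x _ => by rw [ENNReal.toReal_mul, mul_assoc]

theorem expect_map (p : PMF X) (g : X → Y) (f : Y → ℝ) :
    (p.map g).expect f = p.expect fun x => f (g x) := by
  rw [← bind_pure_comp, expect_bind]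
  simp [expect_pure]

theorem integral_toMeasure_eq_expect [MeasurableSpace X] [DiscreteMeasurableSpace X]
    (p : PMF X) (f : X → ℝ) :
    ∫ x, f x ∂p.toMeasure = p.expect f := by
  cases nonempty_fintype X
  rw [PMF.integral_eq_sum, expect_eq_sum]
  simp

end PMF

namespace RabinGame

variable {S A : Type*} [Finite S] [Finite A] {G : RabinGame S A}

instance (s₀ : S) (σ : G.SysStrategy) (τ : G.EnvStrategy) :
    IsProbabilityMeasure (G.runMeasure s₀ σ τ) := by
  unfold runMeasure
  infer_instance

/-! ### One-step laws of the run measure -/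

section OneStep

variable {s₀ : S} {σ : G.SysStrategy} {τ : G.EnvStrategy}

theorem map_eval_zero_runMeasure :
    (G.runMeasure s₀ σ τ).map (fun π => π 0) = (G.startDist σ τ s₀).toMeasure := by
  have h : (G.runMeasure s₀ σ τ).map (Preorder.frestrictLe (π := fun _ => Step S A) 0) =
      (G.startDist σ τ s₀).toMeasure.map
        (MeasurableEquiv.piUnique (fun _ : Finset.Iic 0 => Step S A)).symm := by
    rw [runMeasure, Kernel.trajMeasure, Measure.map_comp _ _ (by fun_prop),
      Kernel.traj_map_frestrictLe, Kernel.partialTraj_self, Measure.id_comp]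
  have h' := congrArg (Measure.map fun f : Finset.Iic 0 → Step S A =>
    f ⟨0, Finset.mem_Iic.2 le_rfl⟩) h
  rw [Measure.map_map (by fun_prop) (by fun_prop),
    Measure.map_map (by fun_prop) (by fun_prop)] at h'
  exact h'.trans Measure.map_id

theorem integral_eval_zero (f : Step S A → ℝ) :
    ∫ π, f (π 0) ∂(G.runMeasure s₀ σ τ) =
      (G.actionDist σ τ s₀ σ.init τ.init).expect fun a => f (s₀, a) := by
  rw [← integral_map (φ := fun π : Run S A => π 0) (measurable_pi_apply 0).aemeasurable
      (Measurable.of_discrete.aestronglyMeasurable), map_eval_zero_runMeasure,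
    PMF.integral_toMeasure_eq_expect, startDist]
  exact PMF.expect_map _ (fun a => ((s₀, a) : Step S A)) f

/-- The history of the steps `0, …, n`. -/
abbrev hist (n : ℕ) (π : Run S A) : Finset.Iic n → Step S A :=
  Preorder.frestrictLe (π := fun _ => Step S A) n π

theorem integrable_of_finite {X : Type*} [Finite X] [MeasurableSpace X] [DiscreteMeasurableSpace X]
    {Ω : Type*} [MeasurableSpace Ω] {μ : Measure Ω} [IsFiniteMeasure μ] {g : Ω → X}
    (hg : Measurable g) (f : X → ℝ) : Integrable (fun ω => f (g ω)) μ := by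
  obtain ⟨C, hC⟩ := (Set.finite_range fun x => ‖f x‖).bddAbove
  exact Integrable.of_bound (Measurable.of_discrete.comp hg).aestronglyMeasurable C
    (ae_of_all _ fun ω => hC ⟨g ω, rfl⟩)

/-- Disintegration of the joint law of history and next step. Every later statement about a single
transition is an instance, for a suitable `F`. -/
theorem integral_hist_succ (n : ℕ) (F : (Finset.Iic n → Step S A) → Step S A → ℝ) :
    ∫ π, F (hist n π) (π (n + 1)) ∂(G.runMeasure s₀ σ τ) =
      ∫ π, (G.stepDist σ τ n (hist n π)).expect (F (hist n π)) ∂(G.runMeasure s₀ σ τ) := by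
  have key := Kernel.map_frestrictLe_trajMeasure_compProd_eq_map_trajMeasure
    (X := fun _ => Step S A) (μ₀ := (G.startDist σ τ s₀).toMeasure) (κ := G.stepKernel σ τ) (a := n)
  change (G.runMeasure s₀ σ τ).map _ ⊗ₘ _ = (G.runMeasure s₀ σ τ).map _ at key
  have h1 : ∫ π, F (hist n π) (π (n + 1)) ∂(G.runMeasure s₀ σ τ) =
      ∫ y, F y.1 y.2 ∂((G.runMeasure s₀ σ τ).map fun π => (hist n π, π (n + 1))) := by
    rw [integral_map (by fun_prop) Measurable.of_discrete.aestronglyMeasurable]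
  rw [h1, ← key, Measure.integral_compProd, integral_map (by fun_prop)]
  · refine integral_congr_ae (ae_of_all _ fun π => ?_)
    exact PMF.integral_toMeasure_eq_expect _ _
  · exact Measurable.of_discrete.aestronglyMeasurable
  · rw [key]
    exact integrable_of_finite
      (μ := (G.runMeasure s₀ σ τ).map fun π => (hist n π, π (n + 1)))
      measurable_id fun y => F y.1 y.2

theorem expect_stepDist (n : ℕ) (h : Finset.Iic n → Step S A) (f : Step S A → ℝ) :
    (G.stepDist σ τ n h).expect f =
      (G.T (h ⟨n, Finset.mem_Iic.2 le_rfl⟩).1 (h ⟨n, Finset.mem_Iic.2 le_rfl⟩).2).expect fun s' =>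
        (G.actionDist σ τ s' (σ.memory (historyState h) (n + 1))
          (τ.memory (historyState h) (n + 1))).expect fun a' => f (s', a') := by
  simp only [stepDist, PMF.expect_bind]
  exact PMF.expect_congr fun s' _ => PMF.expect_map _ (fun a' => ((s', a') : Step S A)) f

/-- The form of the one-step law that the conditional Borel–Cantelli lemma requires. -/
theorem condExp_succ (n : ℕ) (f : Step S A → ℝ) :
    (G.runMeasure s₀ σ τ)[fun π => f (π (n + 1)) | Filtration.piLE (X := fun _ => Step S A) n]
      =ᵐ[G.runMeasure s₀ σ τ] fun π => (G.stepDist σ τ n (hist n π)).expect f := by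
  classical
  refine (ae_eq_condExp_of_forall_setIntegral_eq (Filtration.piLE.le _)
    (integrable_of_finite (by fun_prop) f) (fun s _ _ => (integrable_of_finite
      (g := hist n) (by fun_prop) (fun h => (G.stepDist σ τ n h).expect f)).integrableOn)
    ?_ ?_).symm <;> rw [Filtration.piLE_eq_comap_frestrictLe]
  · rintro - ⟨t, mt, rfl⟩ -
    have hm : MeasurableSet (hist (S := S) (A := A) n ⁻¹' t) := by
      exact (Preorder.measurable_frestrictLe n) mt
    -- The event `t` depends on the history alone, so its indicator can be absorbed into the test
    -- function.
    have := integral_hist_succ (s₀ := s₀) (σ := σ) (τ := τ) n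
      (fun h x => if h ∈ t then f x else 0)
    rw [← integral_indicator hm, ← integral_indicator hm]
    refine (Eq.trans (integral_congr_ae (ae_of_all _ fun π => ?_)) this.symm).trans
      (integral_congr_ae (ae_of_all _ fun π => ?_))
    · by_cases h : hist n π ∈ t <;> simp [Set.indicator, h, PMF.expect_const]
    · by_cases h : hist n π ∈ t <;> simp [Set.indicator, h]
  · have : Measurable[MeasurableSpace.pi.comap (hist (S := S) (A := A) n)]
        (fun π => (G.stepDist σ τ n (hist n π)).expect f) :=
      (Measurable.of_discrete (f := fun h => (G.stepDist σ τ n h).expect f)).comp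
        (comap_measurable _)
    exact this.stronglyMeasurable.aestronglyMeasurable

end OneStep

/-! ### Discounted values -/

/-- The expected one-step reward plus discounted continuation `f`. -/
def lookahead (G : RabinGame S A) (R : S → A → S → ℝ) (γ : ℝ) (f : S → ℝ) (s : S) (a : A) : ℝ :=
  (G.T s a).expect fun s' => R s a s' + γ * f s'

theorem lookahead_neg (R : S → A → S → ℝ) (γ : ℝ) (f : S → ℝ) (s : S) (a : A) :
    G.lookahead (fun s a s' => -R s a s') γ (fun s => -f s) s a = -G.lookahead R γ f s a := by
  rw [lookahead, lookahead, neg_eq_neg_one_mul, ← PMF.expect_const_mul]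
  exact PMF.expect_congr fun s' _ => by ring

theorem lookahead_mono {R : S → A → S → ℝ} {γ : ℝ} (hγ : 0 ≤ γ) {f g : S → ℝ}
    (h : ∀ s, f s ≤ g s) (s : S) (a : A) : G.lookahead R γ f s a ≤ G.lookahead R γ g s a :=
  PMF.expect_mono fun s' _ => add_le_add_right (mul_le_mul_of_nonneg_left (h s') hγ) _

theorem lookahead_add_const (R : S → A → S → ℝ) (γ c : ℝ) (f : S → ℝ) (s : S) (a : A) :
    G.lookahead R γ (fun s => f s + c) s a = G.lookahead R γ f s a + γ * c := by
  rw [lookahead, lookahead, ← PMF.expect_const (G.T s a) (γ * c), ← PMF.expect_add]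
  exact PMF.expect_congr fun s' _ => by ring

section Value

variable {R : S → A → S → ℝ} {γ : ℝ} {s₀ : S} {σ : G.SysStrategy} {τ : G.EnvStrategy}

theorem integral_reward_add (f : S → ℝ) (n : ℕ) :
    ∫ π, R (π n).1 (π n).2 (π (n + 1)).1 ∂(G.runMeasure s₀ σ τ) +
        γ * ∫ π, f (π (n + 1)).1 ∂(G.runMeasure s₀ σ τ) =
      ∫ π, G.lookahead R γ f (π n).1 (π n).2 ∂(G.runMeasure s₀ σ τ) := by
  have h := integral_hist_succ (s₀ := s₀) (σ := σ) (τ := τ) n fun h x =>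
    R (h ⟨n, Finset.mem_Iic.2 le_rfl⟩).1 (h ⟨n, Finset.mem_Iic.2 le_rfl⟩).2 x.1 + γ * f x.1
  simp only [expect_stepDist, PMF.expect_const] at h
  rw [← integral_const_mul, ← integral_add]
  · exact h
  · exact integrable_of_finite (g := fun π : Run S A => (π n, π (n + 1))) (by fun_prop)
      fun x => R x.1.1 x.1.2 x.2.1
  · exact integrable_of_finite (g := fun π : Run S A => π (n + 1)) (by fun_prop)
      fun x => γ * f x.1

/-- The hypothesis is uniform in the memory states, so it applies to whatever memory the random
history has produced. -/
theorem integral_le_integral_lookahead {f : S → ℝ}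
    (h : ∀ s m k, f s ≤ (G.actionDist σ τ s m k).expect (G.lookahead R γ f s)) (n : ℕ) :
    ∫ π, f (π n).1 ∂(G.runMeasure s₀ σ τ) ≤
      ∫ π, G.lookahead R γ f (π n).1 (π n).2 ∂(G.runMeasure s₀ σ τ) := by
  cases n with
  | zero =>
    rw [integral_eval_zero (fun x => f x.1),
      integral_eval_zero (fun x => G.lookahead R γ f x.1 x.2)]
    exact (PMF.expect_const _ _).trans_le (h s₀ _ _)
  | succ n =>
    rw [integral_hist_succ n fun _ x => f x.1,
      integral_hist_succ n fun _ x => G.lookahead R γ f x.1 x.2]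
    refine integral_mono (integrable_of_finite (g := hist n) (by fun_prop) fun h =>
        (G.stepDist σ τ n h).expect fun x => f x.1)
      (integrable_of_finite (g := hist n) (by fun_prop) fun h =>
        (G.stepDist σ τ n h).expect fun x => G.lookahead R γ f x.1 x.2) fun π => ?_
    simp only [expect_stepDist, PMF.expect_const]
    exact PMF.expect_mono fun s' _ => h s' _ _

/-- Rewards are bounded because there are finitely many steps, so a geometric series justifies
exchanging sum and integral. -/
theorem hasSum_value (hγ0 : 0 ≤ γ) (hγ1 : γ < 1) :
    HasSum (fun n : ℕ => γ ^ n * ∫ π, R (π n).1 (π n).2 (π (n + 1)).1 ∂(G.runMeasure s₀ σ τ))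
      (G.value R γ s₀ σ τ) := by
  obtain ⟨C, hC⟩ := (Set.finite_range fun x : (S × A) × S => ‖R x.1.1 x.1.2 x.2‖).bddAbove
  have hi : ∀ n : ℕ, Integrable (fun π : Run S A => γ ^ n * R (π n).1 (π n).2 (π (n + 1)).1)
      (G.runMeasure s₀ σ τ) := fun n =>
    integrable_of_finite (g := fun π : Run S A => (π n, π (n + 1))) (by fun_prop)
      fun x => γ ^ n * R x.1.1 x.1.2 x.2.1
  have := hasSum_integral_of_summable_integral_norm hi <|
    Summable.of_nonneg_of_le (fun n => integral_nonneg fun _ => norm_nonneg _) (fun n => by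
      refine (integral_mono (hi n).norm (integrable_const (γ ^ n * C)) fun π => ?_).trans
        (by simp)
      simp only [norm_mul, norm_pow, Real.norm_of_nonneg hγ0]
      exact mul_le_mul_of_nonneg_left (hC ⟨((_, _), _), rfl⟩) (by positivity))
    ((summable_geometric_of_lt_one hγ0 hγ1).mul_right C)
  simp only [integral_const_mul] at this
  exact this

/-- A subsolution of the optimality equation is a lower bound for the value. -/
theorem le_value (hγ0 : 0 ≤ γ) (hγ1 : γ < 1) {f : S → ℝ}
    (h : ∀ s m k, f s ≤ (G.actionDist σ τ s m k).expect (G.lookahead R γ f s)) :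
    f s₀ ≤ G.value R γ s₀ σ τ := by
  set e : ℕ → ℝ := fun n => ∫ π, f (π n).1 ∂(G.runMeasure s₀ σ τ) with he
  set r : ℕ → ℝ := fun n => ∫ π, R (π n).1 (π n).2 (π (n + 1)).1 ∂(G.runMeasure s₀ σ τ) with hr
  -- Iterating this inequality gives partial sums of the discounted rewards; the remainder γ^n e(n)
  -- vanishes because `f` is bounded.
  have hstep : ∀ n, e n ≤ r n + γ * e (n + 1) := fun n =>
    (integral_le_integral_lookahead h n).trans (integral_reward_add f n).ge
  have hsum : ∀ n, e 0 - γ ^ n * e n ≤ ∑ t ∈ Finset.range n, γ ^ t * r t := by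
    intro n
    induction n with
    | zero => simp
    | succ n ih =>
      rw [Finset.sum_range_succ]
      have := mul_le_mul_of_nonneg_left (hstep n) (pow_nonneg hγ0 n)
      rw [pow_succ]
      linarith
  have he0 : e 0 = f s₀ := by
    rw [he]
    simp only
    exact (integral_eval_zero (fun x => f x.1)).trans (PMF.expect_const _ (f s₀))
  obtain ⟨C, hC⟩ := (Set.finite_range fun s => ‖f s‖).bddAbove
  have hbound : ∀ n, ‖e n‖ ≤ C := fun n =>
    (norm_integral_le_of_norm_le_const (ae_of_all _ fun π => hC ⟨_, rfl⟩)).trans (by simp)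
  have hlim : Tendsto (fun n => e 0 - γ ^ n * e n) atTop (nhds (e 0 - 0)) := by
    refine tendsto_const_nhds.sub ?_
    refine squeeze_zero_norm (a := fun n => γ ^ n * C) (fun n => ?_) ?_
    · rw [norm_mul, norm_pow, Real.norm_of_nonneg hγ0]
      exact mul_le_mul_of_nonneg_left (hbound n) (by positivity)
    · simpa using (tendsto_pow_atTop_nhds_zero_of_lt_one hγ0 hγ1).mul_const C
  rw [sub_zero, he0] at hlim
  exact le_of_tendsto_of_tendsto' hlim (hasSum_value hγ0 hγ1).tendsto_sum_nat
    fun n => he0 ▸ hsum n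

/-- Negating rewards turns supersolutions into subsolutions, so upper bounds follow from `le_value`,
which assumes no sign of the rewards. -/
theorem value_neg :
    G.value (fun s a s' => -R s a s') γ s₀ σ τ = -G.value R γ s₀ σ τ := by
  rw [value, value, ← integral_neg]
  refine integral_congr_ae (ae_of_all _ fun π => ?_)
  simp only [discountedReward, mul_neg, tsum_neg]

/-- A supersolution of the optimality equation is an upper bound for the value. -/
theorem value_le (hγ0 : 0 ≤ γ) (hγ1 : γ < 1) {f : S → ℝ}
    (h : ∀ s m k, (G.actionDist σ τ s m k).expect (G.lookahead R γ f s) ≤ f s) :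
    G.value R γ s₀ σ τ ≤ f s₀ := by
  have := le_value (R := fun s a s' => -R s a s') (f := fun s => -f s) (s₀ := s₀) (σ := σ) (τ := τ)
    hγ0 hγ1 fun s m k => by
      refine (neg_le_neg (h s m k)).trans_eq ?_
      rw [neg_eq_neg_one_mul, ← PMF.expect_const_mul]
      exact PMF.expect_congr fun a _ => by rw [lookahead_neg, neg_one_mul]
  rw [value_neg] at this
  exact neg_le_neg_iff.1 this

theorem value_nonneg (hγ0 : 0 ≤ γ) (hγ1 : γ < 1) (hR0 : ∀ s a s', 0 ≤ R s a s') :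
    0 ≤ G.value R γ s₀ σ τ :=
  le_value (f := fun _ => 0) hγ0 hγ1 fun _ _ _ =>
    PMF.le_expect fun a _ => PMF.le_expect fun s' _ => by simpa using hR0 _ a s'

theorem lookahead_le {Rmax : ℝ} (hγ0 : 0 ≤ γ) (hγ1 : γ < 1)
    (hR : ∀ s a s', R s a s' ≤ Rmax) {f : S → ℝ} (hf : ∀ s, f s ≤ Rmax / (1 - γ)) (s : S) (a : A) :
    G.lookahead R γ f s a ≤ Rmax / (1 - γ) := by
  have h : Rmax / (1 - γ) = Rmax + γ * (Rmax / (1 - γ)) := by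
    field_simp [(sub_pos.2 hγ1).ne']
    ring
  rw [h]
  exact PMF.expect_le fun s' _ => add_le_add (hR s a s') (mul_le_mul_of_nonneg_left (hf s') hγ0)

theorem value_le_div {Rmax : ℝ} (hγ0 : 0 ≤ γ) (hγ1 : γ < 1) (hR : ∀ s a s', R s a s' ≤ Rmax) :
    G.value R γ s₀ σ τ ≤ Rmax / (1 - γ) :=
  value_le (f := fun _ => Rmax / (1 - γ)) hγ0 hγ1 fun _ _ _ =>
    PMF.expect_le fun a _ => lookahead_le hγ0 hγ1 hR (fun _ => le_rfl) _ a

end Value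

/-- The memoryless strategy playing the given action distributions. -/
def Strategy.ofDist {P : Set S} (μ : P → PMF A) (hμ : ∀ s, (μ s).support ⊆ G.act s) :
    G.Strategy P where
  Mem := Unit
  countable_mem := inferInstance
  init := ()
  update _ _ := ()
  choice s _ := μ s
  choice_available s _ := hμ s

instance {P : Set S} : Nonempty (G.Strategy P) :=
  ⟨Strategy.ofDist (fun s => PMF.pure (G.act_nonempty s).some) fun s a ha => by
    rw [PMF.mem_support_pure_iff] at ha
    exact ha ▸ (G.act_nonempty s).some_mem⟩

theorem actionDist_of_mem {σ : G.SysStrategy} {τ : G.EnvStrategy} {s : S} (h : s ∈ G.sys)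
    (m : σ.Mem) (k : τ.Mem) : G.actionDist σ τ s m k = σ.choice ⟨s, h⟩ m := dif_pos h

theorem actionDist_of_notMem {σ : G.SysStrategy} {τ : G.EnvStrategy} {s : S} (h : s ∉ G.sys)
    (m : σ.Mem) (k : τ.Mem) : G.actionDist σ τ s m k = τ.choice ⟨s, h⟩ k := dif_neg h

/-! ### The optimality equation and the loss of mixed strategies -/

section OptValue

variable {R : S → A → S → ℝ} {γ Rmax : ℝ}

/-- Real infima and suprema of unbounded families have a default value; boundedness makes those
defining the values genuine. -/
theorem bddBelow_range_value (hγ0 : 0 ≤ γ) (hγ1 : γ < 1) (hR0 : ∀ s a s', 0 ≤ R s a s')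
    (s : S) (σ : G.SysStrategy) : BddBelow (Set.range fun τ => G.value R γ s σ τ) :=
  ⟨0, by rintro _ ⟨τ, rfl⟩; exact value_nonneg hγ0 hγ1 hR0⟩

theorem bddAbove_range_strategyValue (hγ0 : 0 ≤ γ) (hγ1 : γ < 1) (hR0 : ∀ s a s', 0 ≤ R s a s')
    (hR : ∀ s a s', R s a s' ≤ Rmax) (s : S) :
    BddAbove (Set.range fun σ => G.strategyValue R γ s σ) :=
  ⟨Rmax / (1 - γ), by
    rintro _ ⟨σ, rfl⟩
    exact (ciInf_le (bddBelow_range_value hγ0 hγ1 hR0 s σ) (Classical.arbitrary _)).trans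
      (value_le_div hγ0 hγ1 hR)⟩

/-- A function that satisfies the optimality equation is the optimal value. -/
theorem optValue_eq_of_isGreatest_of_isLeast (hγ0 : 0 ≤ γ) (hγ1 : γ < 1)
    (hR0 : ∀ s a s', 0 ≤ R s a s') (hR : ∀ s a s', R s a s' ≤ Rmax) {u : S → ℝ}
    (hsys : ∀ s ∈ G.sys, IsGreatest (G.lookahead R γ u s '' G.act s) (u s))
    (henv : ∀ s ∉ G.sys, IsLeast (G.lookahead R γ u s '' G.act s) (u s)) :
    G.optValue R γ = u := by
  have hs : ∀ s : G.sys, ∃ a ∈ G.act s, G.lookahead R γ u s a = u s := fun s => (hsys s s.2).1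
  have he : ∀ s : (G.sysᶜ : Set S), ∃ a ∈ G.act s, G.lookahead R γ u s a = u s :=
    fun s => (henv s s.2).1
  choose a ha hau using hs
  choose b hb hbu using he
  -- Both players play pure optimizers for `u`. Then `τ` keeps every system strategy at or below
  -- `u`, and `σ` guarantees `u` against every environment strategy.
  let σ : G.SysStrategy := Strategy.ofDist (fun s => PMF.pure (a s)) fun s x hx => by
    rw [PMF.mem_support_pure_iff] at hx
    exact hx ▸ ha s
  let τ : G.EnvStrategy := Strategy.ofDist (fun s => PMF.pure (b s)) fun s x hx => by
    rw [PMF.mem_support_pure_iff] at hx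
    exact hx ▸ hb s
  funext s₀
  refine le_antisymm ?_ ?_
  · refine ciSup_le fun σ' => (ciInf_le (bddBelow_range_value hγ0 hγ1 hR0 s₀ σ') τ).trans ?_
    refine value_le hγ0 hγ1 fun s m k => ?_
    by_cases h : s ∈ G.sys
    · rw [actionDist_of_mem h]
      exact PMF.expect_le fun x hx =>
        (hsys s h).2 ⟨x, σ'.choice_available ⟨s, h⟩ m hx, rfl⟩
    · rw [actionDist_of_notMem h]
      exact (PMF.expect_pure _ _).trans_le (hbu ⟨s, h⟩).le
  · refine le_ciSup_of_le (bddAbove_range_strategyValue hγ0 hγ1 hR0 hR s₀) σ ?_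
    refine le_ciInf fun τ' => ?_
    refine le_value hγ0 hγ1 fun s m k => ?_
    by_cases h : s ∈ G.sys
    · rw [actionDist_of_mem h]
      exact (hau ⟨s, h⟩).ge.trans_eq (PMF.expect_pure _ _).symm
    · rw [actionDist_of_notMem h]
      exact PMF.le_expect fun x hx =>
        (henv s h).2 ⟨x, τ'.choice_available ⟨s, h⟩ k hx, rfl⟩

open Classical in
/-- The optimality (Shapley) operator. -/
def shapley (G : RabinGame S A) (R : S → A → S → ℝ) (γ : ℝ) (f : S → ℝ) (s : S) : ℝ :=
  if s ∈ G.sys then sSup (G.lookahead R γ f s '' G.act s)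
  else sInf (G.lookahead R γ f s '' G.act s)

theorem isGreatest_shapley (f : S → ℝ) {s : S} (h : s ∈ G.sys) :
    IsGreatest (G.lookahead R γ f s '' G.act s) (G.shapley R γ f s) := by
  rw [shapley, if_pos h]
  exact ⟨((G.act_nonempty s).image _).csSup_mem (Set.toFinite _),
    fun x hx => le_csSup (Set.toFinite _).bddAbove hx⟩

theorem isLeast_shapley (f : S → ℝ) {s : S} (h : s ∉ G.sys) :
    IsLeast (G.lookahead R γ f s '' G.act s) (G.shapley R γ f s) := by
  rw [shapley, if_neg h]
  exact ⟨((G.act_nonempty s).image _).csInf_mem (Set.toFinite _),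
    fun x hx => csInf_le (Set.toFinite _).bddBelow hx⟩

/-- Monotonicity together with discounting of constants: this is the contraction estimate in
one-sided form. -/
theorem shapley_le_add (hγ : 0 ≤ γ) {f g : S → ℝ} {c : ℝ} (h : ∀ s, f s ≤ g s + c) (s : S) :
    G.shapley R γ f s ≤ G.shapley R γ g s + γ * c := by
  have key : ∀ a, G.lookahead R γ f s a ≤ G.lookahead R γ g s a + γ * c := fun a =>
    (lookahead_mono hγ h s a).trans_eq (lookahead_add_const R γ c g s a)
  by_cases hs : s ∈ G.sys
  · obtain ⟨a, ha, hfa⟩ := (isGreatest_shapley (R := R) (γ := γ) f hs).1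
    rw [← hfa]
    exact (key a).trans (add_le_add_left ((isGreatest_shapley g hs).2 ⟨a, ha, rfl⟩) _)
  · obtain ⟨a, ha, hga⟩ := (isLeast_shapley (R := R) (γ := γ) g hs).1
    rw [← hga]
    exact ((isLeast_shapley f hs).2 ⟨a, ha, rfl⟩).trans (key a)

theorem exists_shapley_fixedPoint (hγ0 : 0 ≤ γ) (hγ1 : γ < 1) :
    ∃ u, G.shapley R γ u = u := by
  cases nonempty_fintype S
  have hc : ContractingWith ⟨γ, hγ0⟩ (G.shapley R γ) := by
    refine ⟨hγ1, LipschitzWith.of_dist_le_mul fun f g => ?_⟩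
    refine (dist_pi_le_iff (by positivity)).2 fun s => ?_
    have hfg : ∀ f g : S → ℝ, G.shapley R γ f s ≤ G.shapley R γ g s + γ * dist f g :=
      fun f g => shapley_le_add hγ0 (fun t => by
        have := (le_abs_self _).trans (dist_le_pi_dist f g t)
        linarith) s
    rw [Real.dist_eq, abs_sub_le_iff]
    have h1 := hfg f g
    have h2 := hfg g f
    rw [dist_comm g f] at h2
    exact ⟨sub_le_iff_le_add'.2 h1, sub_le_iff_le_add'.2 h2⟩
  exact ⟨hc.fixedPoint, hc.fixedPoint_isFixedPt⟩

/-- Banach's theorem supplies a fixed point, and the verification theorem identifies it with the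
optimal value. -/
theorem shapley_optValue (hγ0 : 0 ≤ γ) (hγ1 : γ < 1)
    (hR0 : ∀ s a s', 0 ≤ R s a s') (hR : ∀ s a s', R s a s' ≤ Rmax) :
    G.shapley R γ (G.optValue R γ) = G.optValue R γ := by
  obtain ⟨u, hu⟩ := G.exists_shapley_fixedPoint (R := R) hγ0 hγ1
  have : G.optValue R γ = u := optValue_eq_of_isGreatest_of_isLeast hγ0 hγ1 hR0 hR
    (fun s h => by simpa only [hu] using isGreatest_shapley (R := R) (γ := γ) u h)
    (fun s h => by simpa only [hu] using isLeast_shapley (R := R) (γ := γ) u h)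
  rw [this, hu]

theorem optValue_le_div (hγ0 : 0 ≤ γ) (hγ1 : γ < 1)
    (hR0 : ∀ s a s', 0 ≤ R s a s') (hR : ∀ s a s', R s a s' ≤ Rmax) (s : S) :
    G.optValue R γ s ≤ Rmax / (1 - γ) :=
  ciSup_le fun σ =>
    (ciInf_le (bddBelow_range_value hγ0 hγ1 hR0 s σ) (Classical.arbitrary _)).trans
      (value_le_div hγ0 hγ1 hR)

theorem qValue_eq_lookahead (s : S) (a : A) :
    G.qValue R γ s a = G.lookahead R γ (G.optValue R γ) s a := rfl

theorem optValue_le_qValue_of_notMem (hγ0 : 0 ≤ γ) (hγ1 : γ < 1)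
    (hR0 : ∀ s a s', 0 ≤ R s a s') (hR : ∀ s a s', R s a s' ≤ Rmax) {s : S} (hs : s ∉ G.sys)
    {a : A} (ha : a ∈ G.act s) : G.optValue R γ s ≤ G.qValue R γ s a := by
  have := isLeast_shapley (R := R) (γ := γ) (G.optValue R γ) hs
  rw [shapley_optValue hγ0 hγ1 hR0 hR] at this
  exact this.2 ⟨a, ha, rfl⟩

theorem optValue_le_qValue_of_mem_optAct (hγ0 : 0 ≤ γ) (hγ1 : γ < 1)
    (hR0 : ∀ s a s', 0 ≤ R s a s') (hR : ∀ s a s', R s a s' ≤ Rmax) {s : S} (hs : s ∈ G.sys)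
    {a : A} (ha : a ∈ G.optAct R γ s) : G.optValue R γ s ≤ G.qValue R γ s a := by
  have := isGreatest_shapley (R := R) (γ := γ) (G.optValue R γ) hs
  rw [shapley_optValue hγ0 hγ1 hR0 hR] at this
  obtain ⟨b, hb, hbv⟩ := this.1
  rw [← hbv]
  exact ha.2 b hb

/-- A system strategy that, whatever its memory, mixes optimal actions with weight `1 - p` and
arbitrary actions with weight `p` loses at most `ε`, if `p` is small enough. -/
theorem epsOptimal_of_mixture (hγ0 : 0 ≤ γ) (hγ1 : γ < 1)
    (hR0 : ∀ s a s', 0 ≤ R s a s') (hR : ∀ s a s', R s a s' ≤ Rmax) {p ε : ℝ}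
    (hp : p ∈ Set.Icc (0 : ℝ) 1) (hpε : p * (Rmax / (1 - γ)) ≤ ε * (1 - γ + p * γ))
    (σ : G.SysStrategy)
    (hσ : ∀ (s : G.sys) m, ∃ μ ν : PMF A, ν.support ⊆ G.optAct R γ s ∧
      ∀ f : A → ℝ, (σ.choice s m).expect f = p * μ.expect f + (1 - p) * ν.expect f) :
    G.EpsOptimal R γ ε σ := by
  intro s₀
  set v := G.optValue R γ with hv
  have hla : ∀ s a, G.qValue R γ s a - γ * ε ≤ G.lookahead R γ (fun s => max 0 (v s - ε)) s a := by
    intro s a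
    refine le_trans ?_ (lookahead_mono hγ0 (fun t => le_max_right 0 (v t - ε)) s a)
    have := G.lookahead_add_const R γ (-ε) v s a
    simp only [← sub_eq_add_neg] at this
    rw [this, qValue_eq_lookahead]
    linarith
  have hla0 : ∀ s a, 0 ≤ G.lookahead R γ (fun s => max 0 (v s - ε)) s a := by
    intro s a
    exact PMF.le_expect fun s' _ => add_nonneg (hR0 s a s') (mul_nonneg hγ0 (le_max_left _ _))
  refine le_ciInf fun τ => (le_max_right 0 (v s₀ - ε)).trans ?_
  -- Truncating at 0 lets the free component be bounded by 0 rather than by -γε. This saves the term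
  -- pγε, without which the stated p would be too large for the estimate.
  refine le_value (f := fun s => max 0 (v s - ε)) hγ0 hγ1 fun s m k => ?_
  have hnn : ∀ μ : PMF A, 0 ≤ μ.expect (G.lookahead R γ (fun s => max 0 (v s - ε)) s) :=
    fun μ => PMF.le_expect fun a _ => hla0 s a
  refine max_le (hnn _) ?_
  by_cases h : s ∈ G.sys
  · rw [actionDist_of_mem h]
    obtain ⟨μ, ν, hν, hμν⟩ := hσ ⟨s, h⟩ m
    rw [hμν]
    have h1 : v s - γ * ε ≤ ν.expect (G.lookahead R γ (fun s => max 0 (v s - ε)) s) := by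
      refine PMF.le_expect fun a ha => le_trans ?_ (hla s a)
      have := optValue_le_qValue_of_mem_optAct hγ0 hγ1 hR0 hR h (hν ha)
      linarith
    have h2 := mul_nonneg hp.1 (hnn μ)
    have h3 := mul_le_mul_of_nonneg_left h1 (sub_nonneg.2 hp.2)
    have h4 := mul_le_mul_of_nonneg_left (optValue_le_div (G := G) hγ0 hγ1 hR0 hR s) hp.1
    linarith
  · rw [actionDist_of_notMem h]
    by_cases hε : 0 ≤ ε
    · refine PMF.le_expect fun a ha => le_trans ?_ (hla s a)
      have := optValue_le_qValue_of_notMem hγ0 hγ1 hR0 hR h (τ.choice_available ⟨s, h⟩ k ha)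
      have := mul_le_mul_of_nonneg_right hγ1.le hε
      linarith
    -- A negative ε contradicts `hpε`: its left side is nonnegative and 1 - γ + pγ is positive.
    · exfalso
      have h0 : 0 ≤ Rmax / (1 - γ) :=
        (value_nonneg hγ0 hγ1 hR0).trans (value_le_div (s₀ := s) (σ := σ) (τ := τ) hγ0 hγ1 hR)
      have h1 := mul_nonneg hp.1 h0
      have h2 := mul_nonneg hp.1 hγ0
      nlinarith

end OptValue

/-! ### Almost-sure properties of runs -/

section AlmostSure

variable {s₀ : S} {σ : G.SysStrategy} {τ : G.EnvStrategy}

theorem stepDist_ne_zero_iff (n : ℕ) (h : Finset.Iic n → Step S A) (y : Step S A) :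
    G.stepDist σ τ n h y ≠ 0 ↔
      G.T (h ⟨n, Finset.mem_Iic.2 le_rfl⟩).1 (h ⟨n, Finset.mem_Iic.2 le_rfl⟩).2 y.1 ≠ 0 ∧
        G.actionDist σ τ y.1 (σ.memory (historyState h) (n + 1))
          (τ.memory (historyState h) (n + 1)) y.2 ≠ 0 := by
  rw [← PMF.mem_support_iff, stepDist, PMF.mem_support_bind_iff]
  constructor
  · rintro ⟨s', hs', hy⟩
    obtain ⟨a', ha', rfl⟩ := (PMF.mem_support_map_iff _ _ _).1 hy
    exact ⟨hs', ha'⟩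
  · rintro ⟨h1, h2⟩
    exact ⟨y.1, h1, (PMF.mem_support_map_iff _ _ _).2 ⟨y.2, h2, rfl⟩⟩

theorem ae_eval_zero {P : Step S A → Prop}
    (h : ∀ a, G.actionDist σ τ s₀ σ.init τ.init a ≠ 0 → P (s₀, a)) :
    ∀ᵐ π ∂(G.runMeasure s₀ σ τ), P (π 0) := by
  classical
  have h0 : ∫ π, (if P (π 0) then 0 else 1 : ℝ) ∂(G.runMeasure s₀ σ τ) = 0 := by
    rw [integral_eval_zero fun x => if P x then 0 else 1]
    refine (PMF.expect_congr fun a ha => ?_).trans (PMF.expect_const _ 0)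
    rw [if_pos (h a ha)]
  rw [integral_eq_zero_iff_of_nonneg (fun π => by dsimp only; split_ifs <;> simp)
    (integrable_of_finite (g := fun π : Run S A => π 0) (by fun_prop)
      fun x => if P x then 0 else 1)] at h0
  filter_upwards [h0] with π hπ
  by_contra hP
  simp [hP] at hπ

/-- The indicator of failure has conditional expectation 0 given each history, hence integral 0. -/
theorem ae_hist_succ {n : ℕ} {P : (Finset.Iic n → Step S A) → Step S A → Prop}
    (h : ∀ x y, G.stepDist σ τ n x y ≠ 0 → P x y) :
    ∀ᵐ π ∂(G.runMeasure s₀ σ τ), P (hist n π) (π (n + 1)) := by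
  classical
  have h0 : ∫ π, (if P (hist n π) (π (n + 1)) then 0 else 1 : ℝ) ∂(G.runMeasure s₀ σ τ) = 0 := by
    rw [integral_hist_succ n fun x y => if P x y then 0 else 1]
    refine (integral_congr_ae (ae_of_all _ fun π => ?_)).trans (integral_zero' _ _)
    refine (PMF.expect_congr fun y hy => ?_).trans (PMF.expect_const _ 0)
    rw [if_pos (h _ y hy)]
  rw [integral_eq_zero_iff_of_nonneg (fun π => by dsimp only; split_ifs <;> simp)
    (integrable_of_finite (g := fun π : Run S A => (hist n π, π (n + 1))) (by fun_prop)
      fun x => if P x.1 x.2 then 0 else 1)] at h0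
  filter_upwards [h0] with π hπ
  by_contra hP
  simp [hP] at hπ

theorem ae_forall_mem {K : Set (Step S A)}
    (h : ∀ s m k a, G.actionDist σ τ s m k a ≠ 0 → (s, a) ∈ K) :
    ∀ᵐ π ∂(G.runMeasure s₀ σ τ), ∀ n, π n ∈ K := by
  refine ae_all_iff.2 fun n => ?_
  cases n with
  | zero => exact ae_eval_zero fun a ha => h _ _ _ a ha
  | succ n =>
    exact ae_hist_succ (P := fun _ y => y ∈ K) fun x y hy =>
      h y.1 _ _ y.2 ((stepDist_ne_zero_iff n x y).1 hy).2

theorem ae_eval_zero_fst : ∀ᵐ π ∂(G.runMeasure s₀ σ τ), (π 0).1 = s₀ :=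
  ae_eval_zero (P := fun x => x.1 = s₀) fun _ _ => rfl

theorem ae_forall_transition_ne_zero :
    ∀ᵐ π ∂(G.runMeasure s₀ σ τ), ∀ n, G.T (π n).1 (π n).2 (π (n + 1)).1 ≠ 0 :=
  ae_all_iff.2 fun n => ae_hist_succ
    (P := fun x y => G.T (x ⟨n, Finset.mem_Iic.2 le_rfl⟩).1 (x ⟨n, Finset.mem_Iic.2 le_rfl⟩).2 y.1
      ≠ 0) fun x y hy => ((stepDist_ne_zero_iff n x y).1 hy).1

theorem not_ae_eval_zero_ne {a : A} (ha : G.actionDist σ τ s₀ σ.init τ.init a ≠ 0) :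
    ¬∀ᵐ π ∂(G.runMeasure s₀ σ τ), π 0 ≠ (s₀, a) := by
  classical
  intro h
  have h0 : ∫ π, (if (π 0).2 = a then 1 else 0 : ℝ) ∂(G.runMeasure s₀ σ τ) = 0 := by
    refine (integral_congr_ae ?_).trans (integral_zero' _ _)
    filter_upwards [h, ae_eval_zero_fst] with π hπ hs
    exact if_neg fun h => hπ (Prod.ext hs h)
  rw [integral_eval_zero fun x => if x.2 = a then 1 else 0] at h0
  exact (ENNReal.toReal_pos ha (PMF.apply_ne_top _ _)).ne' ((PMF.expect_single _ a).symm.trans h0)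

/-- Positive probability is expressed as the negation of almost-sure avoidance. If `y` were avoided
at time n + 1, its conditional probability would vanish almost surely, which is impossible on
histories ending in `x`. -/
theorem not_ae_succ_ne {n : ℕ} {x y : Step S A}
    (hx : ¬∀ᵐ π ∂(G.runMeasure s₀ σ τ), π n ≠ x) (hT : G.T x.1 x.2 y.1 ≠ 0)
    (hy : ∀ m k, G.actionDist σ τ y.1 m k y.2 ≠ 0) :
    ¬∀ᵐ π ∂(G.runMeasure s₀ σ τ), π (n + 1) ≠ y := by
  classical
  refine fun h => hx ?_
  have h0 := integral_hist_succ (s₀ := s₀) (σ := σ) (τ := τ) n fun h z =>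
    if z = y then if h ⟨n, Finset.mem_Iic.2 le_rfl⟩ = x then 1 else 0 else 0
  have h1 : ∫ π, (if π (n + 1) = y then if π n = x then 1 else 0 else 0 : ℝ)
      ∂(G.runMeasure s₀ σ τ) = 0 := by
    refine (integral_congr_ae ?_).trans (integral_zero' _ _)
    filter_upwards [h] with π hπ
    exact if_neg hπ
  have h2 := h0.symm.trans h1
  rw [integral_eq_zero_iff_of_nonneg] at h2
  · filter_upwards [h2] with π hπ hn
    have hn' : hist n π ⟨n, Finset.mem_Iic.2 le_rfl⟩ = x := hn
    have hs : G.stepDist σ τ n (hist n π) y ≠ 0 := by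
      rw [stepDist_ne_zero_iff, hn']
      exact ⟨hT, hy _ _⟩
    simp only [if_pos hn', PMF.expect_single, Pi.zero_apply] at hπ
    exact (ENNReal.toReal_pos hs (PMF.apply_ne_top _ _)).ne' hπ
  · exact fun π => PMF.le_expect fun z _ => by split_ifs <;> simp
  · exact integrable_of_finite (g := hist n) (by fun_prop) fun h =>
      (G.stepDist σ τ n h).expect fun z =>
        if z = y then if h ⟨n, Finset.mem_Iic.2 le_rfl⟩ = x then 1 else 0 else 0

/-! ### Recurrence of states and steps -/

/-- Conditional Borel–Cantelli for visits to a set of steps. -/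
theorem ae_frequently_mem_iff (B : Set (Step S A)) :
    ∀ᵐ π ∂(G.runMeasure s₀ σ τ), (∃ᶠ n in atTop, π n ∈ B) ↔
      Tendsto (fun n => ∑ k ∈ Finset.range n,
        (G.stepDist σ τ k (hist k π)).expect (B.indicator 1)) atTop atTop := by
  have hm : ∀ n, MeasurableSet[Filtration.piLE (X := fun _ => Step S A) n]
      {π : Run S A | π n ∈ B} := fun n => by
    rw [Filtration.piLE_eq_comap_frestrictLe]
    exact ⟨{h | h ⟨n, Finset.mem_Iic.2 le_rfl⟩ ∈ B}, MeasurableSet.of_discrete, rfl⟩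
  have hc : ∀ᵐ π ∂(G.runMeasure s₀ σ τ), ∀ k, _ :=
    ae_all_iff.2 fun k => condExp_succ (s₀ := s₀) (σ := σ) (τ := τ) k (B.indicator 1)
  filter_upwards [ae_mem_limsup_atTop_iff (G.runMeasure s₀ σ τ) hm, hc] with π h1 h2
  rw [mem_limsup_iff_frequently_mem] at h1
  refine h1.trans (iff_of_eq ?_)
  congr 1
  funext n
  exact Finset.sum_congr rfl fun k _ => h2 k

theorem tendsto_sum_atTop_of_frequently {c : ℕ → ℝ} (hc : ∀ n, 0 ≤ c n) {δ : ℝ} (hδ : 0 < δ)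
    (h : ∃ᶠ n in atTop, δ ≤ c n) :
    Tendsto (fun n => ∑ k ∈ Finset.range n, c k) atTop atTop := by
  rw [← not_summable_iff_tendsto_nat_atTop_of_nonneg hc]
  intro hs
  refine h ?_
  filter_upwards [hs.tendsto_atTop_zero.eventually (gt_mem_nhds hδ)] with n hn
  exact not_le.2 hn

theorem expect_stepDist_indicator_fst (n : ℕ) (h : Finset.Iic n → Step S A) (t : S) :
    (G.stepDist σ τ n h).expect (Set.indicator {y | y.1 = t} 1) =
      (G.T (h ⟨n, Finset.mem_Iic.2 le_rfl⟩).1 (h ⟨n, Finset.mem_Iic.2 le_rfl⟩).2 t).toReal := by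
  classical
  rw [expect_stepDist, ← PMF.expect_single]
  refine PMF.expect_congr fun s' _ => ?_
  refine (PMF.expect_congr fun a' _ => ?_).trans
    (PMF.expect_const _ (if s' = t then 1 else 0))
  by_cases hs : s' = t
  · rw [if_pos hs]
    exact Set.indicator_of_mem (s := {y : Step S A | y.1 = t}) hs _
  · rw [if_neg hs]
    exact Set.indicator_of_notMem (s := {y : Step S A | y.1 = t}) hs _

/-- Each occurrence of `x` adds the same positive conditional probability of visiting `t` next, so
the Borel–Cantelli sum diverges. -/
theorem ae_frequently_fst_of_frequently :
    ∀ᵐ π ∂(G.runMeasure s₀ σ τ), ∀ x : Step S A, ∀ t, G.T x.1 x.2 t ≠ 0 →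
      (∃ᶠ n in atTop, π n = x) → ∃ᶠ n in atTop, (π n).1 = t := by
  have : ∀ᵐ π ∂(G.runMeasure s₀ σ τ), ∀ t : S, _ :=
    ae_all_iff.2 fun t => ae_frequently_mem_iff {y : Step S A | y.1 = t}
  filter_upwards [this] with π hπ x t hT hx
  refine (hπ t).2 (tendsto_sum_atTop_of_frequently
    (fun n => PMF.le_expect fun y _ => Set.indicator_nonneg (fun _ _ => zero_le_one) y)
    (ENNReal.toReal_pos hT (PMF.apply_ne_top _ _)) (hx.mono fun n hn => ?_))
  rw [expect_stepDist_indicator_fst]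
  exact (congrArg (fun z : Step S A => (G.T z.1 z.2 t).toReal) hn).ge

/-- State and action of a step are drawn together, so conditioning between them is unavailable.
Instead Borel–Cantelli is used in both directions: the conditional probability of the step is at
least δ times that of its state, so divergence for the state passes to the step. -/
theorem ae_frequently_eq_of_frequently_fst {K : Set (Step S A)}
    (hK : ∀ x ∈ K, ∃ δ > 0, ∀ m k, δ ≤ (G.actionDist σ τ x.1 m k x.2).toReal) :
    ∀ᵐ π ∂(G.runMeasure s₀ σ τ), ∀ x ∈ K,
      (∃ᶠ n in atTop, (π n).1 = x.1) → ∃ᶠ n in atTop, π n = x := by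
  classical
  have h1 : ∀ᵐ π ∂(G.runMeasure s₀ σ τ), ∀ t : S, _ :=
    ae_all_iff.2 fun t => ae_frequently_mem_iff {y : Step S A | y.1 = t}
  have h2 : ∀ᵐ π ∂(G.runMeasure s₀ σ τ), ∀ x : Step S A, _ :=
    ae_all_iff.2 fun x => ae_frequently_mem_iff {x}
  filter_upwards [h1, h2] with π h1 h2 x hx hf
  obtain ⟨δ, hδ, hδx⟩ := hK x hx
  refine (h2 x).2 (tendsto_atTop_mono (fun n => ?_) (((h1 x.1).1 hf).const_mul_atTop hδ))
  rw [Finset.mul_sum]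
  refine Finset.sum_le_sum fun k _ => ?_
  rw [← PMF.expect_const_mul, expect_stepDist, expect_stepDist]
  refine PMF.expect_mono fun s' _ => ?_
  by_cases hs : s' = x.1
  · subst hs
    refine (PMF.expect_le (c := δ) fun a' _ => ?_).trans ?_
    · exact (congrArg (δ * ·) (Set.indicator_of_mem (s := {y : Step S A | y.1 = x.1})
        (f := fun _ => (1 : ℝ)) (a := (x.1, a')) rfl)).le.trans (mul_one δ).le
    · refine (hδx (σ.memory (historyState (hist k π)) (k + 1))
        (τ.memory (historyState (hist k π)) (k + 1))).trans_eq ?_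
      rw [← PMF.expect_single]
      refine PMF.expect_congr fun a' _ => ?_
      by_cases ha : a' = x.2
      · subst ha
        rw [if_pos rfl]
        exact (Set.indicator_of_mem (Set.mem_singleton x) (1 : Step S A → ℝ)).symm
      · rw [if_neg ha]
        exact (Set.indicator_of_notMem (s := {x}) (a := ((x.1, a') : Step S A))
          (fun h => ha (congrArg Prod.snd h)) (1 : Step S A → ℝ)).symm
  · refine (PMF.expect_le (c := 0) fun a' _ => ?_).trans
      (PMF.le_expect fun a' _ => Set.indicator_nonneg (fun _ _ => zero_le_one) _)
    exact (congrArg (δ * ·)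
      (Set.indicator_of_notMem (s := {y : Step S A | y.1 = x.1}) hs _)).le.trans (mul_zero δ).le

end AlmostSure

/-! ### End components -/

/-- The steps that occur infinitely often. -/
def infSteps (π : Run S A) : Set (Step S A) := {x | ∃ᶠ n in atTop, π n = x}

omit [Finite S] in
theorem mem_infSet_iff {π : Run S A} {s : S} : s ∈ infSet π ↔ ∃ a, (s, a) ∈ infSteps π := by
  constructor
  · intro h
    by_contra! hn
    refine h ?_
    have : ∀ᶠ n in atTop, ∀ a, π n ≠ (s, a) :=
      eventually_all.2 fun a => not_frequently.1 (hn a)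
    filter_upwards [this] with n hπ hs
    exact hπ (π n).2 (Prod.ext hs rfl)
  · rintro ⟨a, ha⟩
    exact ha.mono fun n hn => congrArg Prod.fst hn

theorem eventually_mem_infSteps (π : Run S A) : ∀ᶠ n in atTop, π n ∈ infSteps π := by
  have : ∀ᶠ n in atTop, ∀ x, x ∉ infSteps π → π n ≠ x := by
    refine eventually_all.2 fun x => ?_
    by_cases hx : x ∈ infSteps π
    · exact Eventually.of_forall fun n h => absurd hx h
    · exact (not_frequently.1 hx).mono fun n hn _ => hn
  filter_upwards [this] with n hn
  by_contra h
  exact hn _ h rfl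

/-- The steps available when the system plays the memoryless strategy `σ`. -/
def allowedSteps (σ : G.SysStrategy) : Set (Step S A) :=
  {x | x.2 ∈ G.act x.1 ∧ ∀ h : x.1 ∈ G.sys, σ.choice ⟨x.1, h⟩ σ.init x.2 ≠ 0}

/-- Transitions of positive probability along the steps in `J`. -/
def Edge (G : RabinGame S A) (J : Set (Step S A)) (s t : S) : Prop :=
  ∃ a, ((s, a) : Step S A) ∈ J ∧ G.T s a t ≠ 0

/-- The end components of the Markov decision process that the memoryless strategy `σ` leaves to
the environment, as sets of steps. -/
structure IsEndComponent (σ : G.SysStrategy) (J : Set (Step S A)) : Prop where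
  nonempty : J.Nonempty
  subset_allowed : J ⊆ allowedSteps σ
  mem_of_sys : ∀ {s a b}, s ∈ G.sys → ((s, a) : Step S A) ∈ J → (s, b) ∈ allowedSteps σ →
    ((s, b) : Step S A) ∈ J
  closed : ∀ {s t}, G.Edge J s t → ∃ b, ((t, b) : Step S A) ∈ J
  connected : ∀ {s a t b}, ((s, a) : Step S A) ∈ J → ((t, b) : Step S A) ∈ J →
    Relation.ReflTransGen (G.Edge J) s t

/-- The states of a set of steps. -/
def statesOf (J : Set (Step S A)) : Set S := {s | ∃ a, ((s, a) : Step S A) ∈ J}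

/-- The Rabin condition for the set of states visited infinitely often. -/
def RabinSet (G : RabinGame S A) (U : Set S) : Prop :=
  ∃ i : Fin G.d, (U ∩ G.F i).Nonempty ∧ U ∩ G.E i = ∅

omit [Finite S] in
theorem infSet_eq_statesOf (π : Run S A) : infSet π = statesOf (infSteps π) :=
  Set.ext fun _ => mem_infSet_iff

section EndComponent

variable {s₀ : S} {σ : G.SysStrategy}

theorem mem_allowedSteps_of_actionDist_ne_zero (hσ : ∀ m, m = σ.init) {τ : G.EnvStrategy}
    (s : S) (m : σ.Mem) (k : τ.Mem) (a : A) (h : G.actionDist σ τ s m k a ≠ 0) :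
    (s, a) ∈ allowedSteps σ := by
  by_cases hs : s ∈ G.sys
  · rw [actionDist_of_mem hs, hσ m] at h
    exact ⟨σ.choice_available ⟨s, hs⟩ σ.init h, fun _ => h⟩
  · rw [actionDist_of_notMem hs] at h
    exact ⟨τ.choice_available ⟨s, hs⟩ k h, fun h' => absurd h' hs⟩

/-- Almost surely, the steps taken infinitely often form a reachable end component. -/
theorem ae_isEndComponent_infSteps (hσ : ∀ m, m = σ.init) (τ : G.EnvStrategy) :
    ∀ᵐ π ∂(G.runMeasure s₀ σ τ), IsEndComponent σ (infSteps π) ∧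
      ∀ s ∈ infSet π, Relation.ReflTransGen (G.Edge (allowedSteps σ)) s₀ s := by
  -- As `σ` has only one memory state, the probability of an allowed system step is constant in time
  -- and serves as δ.
  have hK : ∀ x ∈ {x : Step S A | x.1 ∈ G.sys ∧ x ∈ allowedSteps σ}, ∃ δ > 0, ∀ m k,
      δ ≤ (G.actionDist σ τ x.1 m k x.2).toReal := by
    rintro x ⟨hs, -, hx⟩
    refine ⟨_, ENNReal.toReal_pos (hx hs) (PMF.apply_ne_top _ _), fun m k => ?_⟩
    rw [actionDist_of_mem hs, hσ m]
  filter_upwards [ae_eval_zero_fst, ae_forall_transition_ne_zero,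
    ae_forall_mem (mem_allowedSteps_of_actionDist_ne_zero hσ), ae_frequently_fst_of_frequently,
    ae_frequently_eq_of_frequently_fst hK] with π h0 hT hall hnext hact
  have hev := eventually_mem_infSteps π
  refine ⟨⟨?_, ?_, ?_, ?_, ?_⟩, ?_⟩
  · obtain ⟨n, hn⟩ := hev.exists
    exact ⟨_, hn⟩
  · intro x hx
    obtain ⟨n, hn⟩ := Frequently.exists (p := fun n => π n = x) hx
    exact hn ▸ hall n
  · intro s a b hs ha hb
    exact hact (s, b) ⟨hs, hb⟩ (mem_infSet_iff.2 ⟨a, ha⟩)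
  · rintro s t ⟨a, ha, hat⟩
    exact mem_infSet_iff.1 (hnext (s, a) t hat ha)
  · intro s a t b hs ht
    obtain ⟨N, hN⟩ := eventually_atTop.1 hev
    obtain ⟨n, hn, hns⟩ := frequently_atTop.1 hs N
    obtain ⟨m, hm, hmt⟩ := frequently_atTop.1 ht n
    -- After time N only recurring steps are taken, so the run itself traces a path from s to t
    -- inside them.
    have key : ∀ k, Relation.ReflTransGen (G.Edge (infSteps π)) (π n).1 (π (n + k)).1 := by
      intro k
      induction k with
      | zero => exact Relation.ReflTransGen.refl
      | succ k ih => exact ih.tail ⟨(π (n + k)).2, hN _ (by omega), hT _⟩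
    have := key (m - n)
    rw [Nat.add_sub_cancel' hm, hns, hmt] at this
    exact this
  · intro s hs
    obtain ⟨n, hn⟩ := Frequently.exists (p := fun n => (π n).1 = s) hs
    rw [← hn, ← h0]
    clear hn hs
    induction n with
    | zero => exact Relation.ReflTransGen.refl
    | succ n ih => exact ih.tail ⟨(π n).2, hall n, hT n⟩

/-- The environment can force its system-closed end components: there is a memoryless strategy
under which precisely the steps of the end component, and outside of it all allowed steps, have
positive probability. -/
theorem exists_envStrategy_of_isEndComponent (hσ : ∀ m, m = σ.init) {J : Set (Step S A)}
    (hJ : IsEndComponent σ J) : ∃ τ : G.EnvStrategy, ∀ s a, ∃ δ : ENNReal,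
      (∀ m k, G.actionDist σ τ s m k a = δ) ∧
        (δ ≠ 0 ↔ (s, a) ∈ allowedSteps σ ∧ (s ∈ statesOf J → ((s, a) : Step S A) ∈ J)) := by
  classical
  cases nonempty_fintype A
  -- Inside `J` the environment randomizes uniformly over the actions that stay in `J`, elsewhere
  -- over all available actions, so that every allowed path towards `J` keeps positive probability.
  let D : S → Set A := fun s => {a | a ∈ G.act s ∧ (s ∈ statesOf J → ((s, a) : Step S A) ∈ J)}
  have hD : ∀ s, (D s).toFinset.Nonempty := by
    intro s
    rw [Set.toFinset_nonempty]
    by_cases h : s ∈ statesOf J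
    · obtain ⟨a, ha⟩ := h
      exact ⟨a, (hJ.subset_allowed ha).1, fun _ => ha⟩
    · obtain ⟨a, ha⟩ := G.act_nonempty s
      exact ⟨a, ha, fun h' => absurd h' h⟩
  have hsupp : ∀ s a, PMF.uniformOfFinset (D s).toFinset (hD s) a ≠ 0 ↔ a ∈ D s := by
    intro s a
    rw [← PMF.mem_support_iff, PMF.mem_support_uniformOfFinset_iff, Set.mem_toFinset]
  refine ⟨Strategy.ofDist (fun s => PMF.uniformOfFinset (D s).toFinset (hD s))
    fun s a ha => ((hsupp s a).1 ha).1, fun s a => ?_⟩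
  by_cases hs : s ∈ G.sys
  · refine ⟨σ.choice ⟨s, hs⟩ σ.init a, fun m k => by rw [actionDist_of_mem hs, hσ m], ?_⟩
    constructor
    · intro h
      have hal : (s, a) ∈ allowedSteps σ :=
        ⟨σ.choice_available ⟨s, hs⟩ σ.init h, fun _ => h⟩
      exact ⟨hal, fun ⟨b, hb⟩ => hJ.mem_of_sys hs hb hal⟩
    · exact fun h => h.1.2 hs
  · refine ⟨PMF.uniformOfFinset (D s).toFinset (hD s) a, fun m k => ?_, ?_⟩
    · rw [actionDist_of_notMem hs]
      rfl
    · rw [hsupp]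
      exact ⟨fun h => ⟨⟨h.1, fun h' => absurd h' hs⟩, h.2⟩, fun h => ⟨h.1.1, h.2⟩⟩

/-- A statement about one fixed run: closedness traps it in `J` after the first visit, and along a
path from one recurring state recurrence spreads to every state of `J`. -/
theorem IsEndComponent.infSet_eq {J : Set (Step S A)} (hJ : IsEndComponent σ J) {π : Run S A}
    (hstep : ∀ n, (π n).1 ∈ statesOf J → π n ∈ J)
    (hT : ∀ n, G.T (π n).1 (π n).2 (π (n + 1)).1 ≠ 0)
    (hnext : ∀ x : Step S A, ∀ t, G.T x.1 x.2 t ≠ 0 →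
      (∃ᶠ n in atTop, π n = x) → ∃ᶠ n in atTop, (π n).1 = t)
    (hact : ∀ x ∈ J, (∃ᶠ n in atTop, (π n).1 = x.1) → ∃ᶠ n in atTop, π n = x)
    (hvisit : ∃ n, (π n).1 ∈ statesOf J) : infSet π = statesOf J := by
  obtain ⟨N, hN⟩ := hvisit
  have hstay : ∀ n ≥ N, (π n).1 ∈ statesOf J := by
    intro n hn
    induction n, hn using Nat.le_induction with
    | base => exact hN
    | succ n _ ih => exact hJ.closed ⟨(π n).2, hstep n ih, hT n⟩
  have hsub : infSet π ⊆ statesOf J := by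
    intro s hs
    obtain ⟨n, hn, hns⟩ := frequently_atTop.1 hs N
    exact hns ▸ hstay n hn
  obtain ⟨n, hn⟩ := (eventually_mem_infSteps π).exists
  have hs : (π n).1 ∈ infSet π := mem_infSet_iff.2 ⟨(π n).2, hn⟩
  refine hsub.antisymm ?_
  rintro t ⟨b, hb⟩
  obtain ⟨a, ha⟩ := hsub hs
  have hpath := hJ.connected ha hb
  clear hb
  induction hpath with
  | refl => exact hs
  | tail _ he ih =>
    obtain ⟨c, hc, hcT⟩ := he
    exact hnext _ _ hcT (hact _ hc ih)

/-- A memoryless system strategy fails to be almost-sure winning exactly if the environment can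
reach an end component whose states violate the Rabin condition. -/
theorem not_almostSureWinning_iff (hσ : ∀ m, m = σ.init) :
    ¬G.AlmostSureWinning σ ↔ ∃ s₀ ∈ G.init, ∃ J, IsEndComponent σ J ∧
      (∃ s ∈ statesOf J, Relation.ReflTransGen (G.Edge (allowedSteps σ)) s₀ s) ∧
      ¬G.RabinSet (statesOf J) := by
  constructor
  · intro h
    simp only [AlmostSureWinning, not_forall] at h
    obtain ⟨s₀, hs₀, τ, hτ⟩ := h
    obtain ⟨π, hπ, hJ, hreach⟩ :=
      ((not_eventually.1 hτ).and_eventually (ae_isEndComponent_infSteps hσ τ)).exists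
    obtain ⟨x, hx⟩ := hJ.nonempty
    refine ⟨s₀, hs₀, infSteps π, hJ, ⟨x.1, ⟨x.2, hx⟩, hreach _ (mem_infSet_iff.2 ⟨x.2, hx⟩)⟩, ?_⟩
    rw [← infSet_eq_statesOf]
    exact hπ
  · rintro ⟨s₀, hs₀, J, hJ, ⟨s, hsJ, hreach⟩, hR⟩ hwin
    obtain ⟨τ, hτ⟩ := exists_envStrategy_of_isEndComponent hσ hJ
    choose δ hδ hδ0 using hτ
    have hpos : ∀ x ∈ J, ∃ δ > 0, ∀ m k, δ ≤ (G.actionDist σ τ x.1 m k x.2).toReal := by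
      intro x hx
      have h0 : δ x.1 x.2 ≠ 0 := (hδ0 _ _).2 ⟨hJ.subset_allowed hx, fun _ => hx⟩
      refine ⟨(δ x.1 x.2).toReal, ENNReal.toReal_pos h0 ?_, fun m k => (hδ x.1 x.2 m k ▸ le_rfl)⟩
      rw [← hδ x.1 x.2 σ.init τ.init]
      exact PMF.apply_ne_top _ _
    -- A run entering `J` visits exactly the states of `J` infinitely often and hence loses, so
    -- almost-sure winning would mean that `J` is almost surely never entered.
    have hnever : ∀ᵐ π ∂(G.runMeasure s₀ σ τ), ∀ n, (π n).1 ∉ statesOf J := by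
      filter_upwards [hwin s₀ hs₀ τ, ae_forall_transition_ne_zero, ae_frequently_fst_of_frequently,
        ae_frequently_eq_of_frequently_fst hpos,
        ae_forall_mem (K := {x | x.1 ∈ statesOf J → x ∈ J}) fun s m k a h =>
          ((hδ0 s a).1 (hδ s a m k ▸ h)).2] with π hw hT hnext hact hstep n hn
      refine hR ?_
      rw [← hJ.infSet_eq hstep hT hnext hact ⟨n, hn⟩]
      exact hw
    have hvisit : ∀ t, (∃ n, ∀ a, δ t a ≠ 0 →
        ¬∀ᵐ π ∂(G.runMeasure s₀ σ τ), π n ≠ (t, a)) → t ∉ statesOf J := by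
      rintro t ⟨n, hn⟩ ⟨a, ha⟩
      refine hn a ((hδ0 _ _).2 ⟨hJ.subset_allowed ha, fun _ => ha⟩) ?_
      filter_upwards [hnever] with π hπ h
      refine hπ n ⟨a, ?_⟩
      rw [h]
      exact ha
    -- Induction along the path to `J`. By `hvisit` the states reached so far lie outside `J`, where
    -- `τ` gives every allowed step positive probability, so the next edge can be followed.
    have hreach' : ∃ n, ∀ a, δ s a ≠ 0 → ¬∀ᵐ π ∂(G.runMeasure s₀ σ τ), π n ≠ (s, a) := by
      clear hsJ
      induction hreach with
      | refl => exact ⟨0, fun a ha => not_ae_eval_zero_ne (by rwa [hδ])⟩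
      | @tail t u _ he ih =>
        obtain ⟨a, ha, hT⟩ := he
        have ht := hvisit t ih
        obtain ⟨n, hn⟩ := ih
        refine ⟨n + 1, fun b hb => not_ae_succ_ne
          (hn a ((hδ0 _ _).2 ⟨ha, fun h => absurd h ht⟩)) hT fun m k => ?_⟩
        rwa [hδ]
    exact hvisit s hreach' hsJ

/-- Every state of an end component has a predecessor in it. -/
theorem IsEndComponent.exists_edge {J : Set (Step S A)} (hJ : IsEndComponent σ J) {t : S}
    (ht : t ∈ statesOf J) : ∃ s, G.Edge J s t := by
  obtain ⟨b, hb⟩ := ht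
  obtain ⟨u, hu⟩ := (G.T t b).support_nonempty
  obtain ⟨c, hc⟩ := hJ.closed ⟨b, hb, hu⟩
  rcases Relation.ReflTransGen.cases_tail (hJ.connected hc hb) with h | ⟨r, -, hr⟩
  · exact ⟨t, b, hb, h ▸ hu⟩
  · exact ⟨r, hr⟩

end EndComponent

end RabinGame

theorem PMF.map_getD_apply {A : Type*} {ν : PMF (Option A)} (h : ν none = 0) (a₀ a : A) :
    ν.map (fun o => o.getD a₀) a = ν (some a) := by
  classical
  rw [PMF.map_apply, tsum_eq_single (some a)]
  · simp
  · rintro (_ | b) hb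
    · simp [h]
    · have : a ≠ b := fun h => hb (h ▸ rfl)
      simp [this]

namespace RabinGame

variable {S A : Type*} [Finite S] [Finite A] {G : RabinGame S A}

theorem coin_true {p : ℝ} (hp : p ∈ Set.Icc (0 : ℝ) 1) : coin p hp true = ENNReal.ofReal p := rfl

theorem coin_false {p : ℝ} (hp : p ∈ Set.Icc (0 : ℝ) 1) :
    coin p hp false = ENNReal.ofReal (1 - p) := rfl

theorem expect_coin {p : ℝ} (hp : p ∈ Set.Icc (0 : ℝ) 1) (f : Bool → ℝ) :
    (coin p hp).expect f = p * f true + (1 - p) * f false := by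
  rw [PMF.expect_eq_sum, Fintype.sum_bool, coin_true, coin_false, ENNReal.toReal_ofReal hp.1,
    ENNReal.toReal_ofReal (sub_nonneg.2 hp.2)]

/-! ### Strategies of the split game -/

section Hat

variable {R : S → A → S → ℝ} {γ p : ℝ} {hp : p ∈ Set.Icc (0 : ℝ) 1}

/-- The action distribution of `σ` at the free copy of `s`. -/
def freeChoice (σ : (G.hat R γ p hp).SysStrategy) (s : G.sys) : PMF (Option A) :=
  σ.choice ⟨G.freeState s, G.freeState_mem s⟩ σ.init

/-- The action distribution of `σ` at the optimal copy of `s`. -/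
def optChoice (σ : (G.hat R γ p hp).SysStrategy) (s : G.sys) : PMF (Option A) :=
  σ.choice ⟨G.optState s, G.optState_mem s⟩ σ.init

variable (σ : (G.hat R γ p hp).SysStrategy)

theorem exists_of_freeChoice_ne_zero {s : G.sys} {x : Option A} (h : freeChoice σ s x ≠ 0) :
    ∃ a ∈ G.act s, some a = x :=
  σ.choice_available ⟨G.freeState s, G.freeState_mem s⟩ σ.init h

theorem exists_of_optChoice_ne_zero {s : G.sys} {x : Option A} (h : optChoice σ s x ≠ 0) :
    ∃ a ∈ G.optAct R γ s, some a = x :=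
  σ.choice_available ⟨G.optState s, G.optState_mem s⟩ σ.init h

theorem freeChoice_none (s : G.sys) : freeChoice σ s none = 0 := by
  by_contra h
  obtain ⟨a, -, ha⟩ := exists_of_freeChoice_ne_zero σ h
  cases ha

theorem optChoice_none (s : G.sys) : optChoice σ s none = 0 := by
  by_contra h
  obtain ⟨a, -, ha⟩ := exists_of_optChoice_ne_zero σ h
  cases ha

/-- The distribution on the actions of `G` that `σ` induces at the copy of `s` selected by the
coin. -/
def copyChoice (s : G.sys) (b : Bool) : PMF A :=
  (bif b then freeChoice σ s else optChoice σ s).map fun o => o.getD (G.act_nonempty s).some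

theorem copyChoice_true_apply (s : G.sys) (a : A) :
    copyChoice σ s true a = freeChoice σ s (some a) :=
  PMF.map_getD_apply (freeChoice_none σ s) _ a

theorem copyChoice_false_apply (s : G.sys) (a : A) :
    copyChoice σ s false a = optChoice σ s (some a) :=
  PMF.map_getD_apply (optChoice_none σ s) _ a

theorem support_copyChoice_false (s : G.sys) : (copyChoice σ s false).support ⊆ G.optAct R γ s := by
  intro a ha
  rw [PMF.mem_support_iff, copyChoice_false_apply] at ha
  obtain ⟨b, hb, hba⟩ := exists_of_optChoice_ne_zero σ ha
  exact Option.some_injective _ hba ▸ hb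

theorem support_copyChoice (s : G.sys) : ∀ b, (copyChoice σ s b).support ⊆ G.act s
  | true => by
    intro a ha
    rw [PMF.mem_support_iff, copyChoice_true_apply] at ha
    obtain ⟨b, hb, hba⟩ := exists_of_freeChoice_ne_zero σ ha
    exact Option.some_injective _ hba ▸ hb
  | false => (support_copyChoice_false σ s).trans fun _ ha => ha.1

/-- The memoryless strategy of `G` that mixes the choices of `σ` at the two copies of a state. -/
def mixedStrategy : G.SysStrategy :=
  Strategy.ofDist (fun s => (coin p hp).bind (copyChoice σ s)) fun s a ha => by
    obtain ⟨b, -, hb⟩ := (PMF.mem_support_bind_iff _ _ _).1 ha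
    exact support_copyChoice σ s b hb

theorem expect_choice_mixedStrategy (s : G.sys) (m : (mixedStrategy σ).Mem) (f : A → ℝ) :
    ((mixedStrategy σ).choice s m).expect f =
      p * (copyChoice σ s true).expect f + (1 - p) * (copyChoice σ s false).expect f :=
  (PMF.expect_bind _ _ _).trans (expect_coin hp _)

theorem toReal_choice_mixedStrategy (s : G.sys) (m : (mixedStrategy σ).Mem) (a : A) :
    ((mixedStrategy σ).choice s m a).toReal =
      p * (freeChoice σ s (some a)).toReal + (1 - p) * (optChoice σ s (some a)).toReal := by
  classical
  rw [← PMF.expect_single, expect_choice_mixedStrategy, PMF.expect_single, PMF.expect_single,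
    copyChoice_true_apply, copyChoice_false_apply]

/-- Only this description of the support enters the comparison of end components. The condition `p <
1` appears because the optimal copy has weight 1 - p. -/
theorem choice_mixedStrategy_ne_zero_iff (hp0 : 0 < p) (s : G.sys) (m : (mixedStrategy σ).Mem)
    (a : A) : (mixedStrategy σ).choice s m a ≠ 0 ↔
      freeChoice σ s (some a) ≠ 0 ∨ p < 1 ∧ optChoice σ s (some a) ≠ 0 := by
  rw [← PMF.mem_support_iff]
  refine (PMF.mem_support_bind_iff _ _ _).trans ?_
  simp only [Bool.exists_bool, PMF.mem_support_iff, copyChoice_true_apply, copyChoice_false_apply,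
    coin_true, coin_false, ne_eq, ENNReal.ofReal_eq_zero, not_le, sub_pos, hp0, true_and]
  exact or_comm

/-- The original state of which `x` is a copy. -/
def baseState : G.HatState → S
  | Sum.inl s => s
  | Sum.inr (Sum.inl s) => s
  | Sum.inr (Sum.inr s) => s

theorem hatT_inl_of_mem_ne_zero_iff (hp0 : 0 < p) {s : S} (hs : s ∈ G.sys) (x : Option A)
    (y : G.HatState) : (G.hat R γ p hp).T (Sum.inl s) x y ≠ 0 ↔
      y = G.freeState ⟨s, hs⟩ ∨ p < 1 ∧ y = G.optState ⟨s, hs⟩ := by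
  have : (G.hat R γ p hp).T (Sum.inl s) x =
      (coin p hp).map fun b => if b then G.freeState ⟨s, hs⟩ else G.optState ⟨s, hs⟩ := dif_pos hs
  rw [this, ← PMF.mem_support_iff, PMF.mem_support_map_iff]
  simp only [Bool.exists_bool, PMF.mem_support_iff, coin_true, coin_false, ne_eq,
    ENNReal.ofReal_eq_zero, not_le, sub_pos, hp0, true_and, if_true, Bool.false_eq_true, if_false]
  rw [or_comm, eq_comm, eq_comm (a := y)]
  simp only [eq_comm]

theorem liftT_some_ne_zero_iff (s : S) (a : A) (y : G.HatState) :
    G.liftT s (some a) y ≠ 0 ↔ ∃ t, y = Sum.inl t ∧ G.T s a t ≠ 0 := by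
  rw [← PMF.mem_support_iff, liftT, PMF.mem_support_map_iff]
  exact ⟨fun ⟨t, h1, h2⟩ => ⟨t, h2.symm, h1⟩, fun ⟨t, h1, h2⟩ => ⟨t, h2, h1.symm⟩⟩

theorem hatT_inl_of_notMem {s : S} (hs : s ∉ G.sys) (x : Option A) :
    (G.hat R γ p hp).T (Sum.inl s) x = G.liftT s x := dif_neg hs

theorem inl_mem_hat_sys_iff {s : S} : Sum.inl s ∈ (G.hat R γ p hp).sys ↔ s ∈ G.sys :=
  ⟨fun h => h s rfl, fun h _ ht => Sum.inl_injective ht ▸ h⟩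

theorem inl_mem_allowedSteps_iff_of_mem {s : S} (hs : s ∈ G.sys) (x : Option A) :
    (Sum.inl s, x) ∈ allowedSteps σ ↔ x = none := by
  have hact : (G.hat R γ p hp).act (Sum.inl s) = {none} := if_pos hs
  constructor
  · intro h
    have := h.1
    rwa [hact] at this
  · rintro rfl
    refine ⟨by rw [hact]; rfl, fun h => ?_⟩
    obtain ⟨y, hy⟩ := (σ.choice ⟨Sum.inl s, h⟩ σ.init).support_nonempty
    have := σ.choice_available _ _ hy
    rw [hact] at this
    exact (show y = none from this) ▸ hy

theorem inl_mem_allowedSteps_iff_of_notMem {s : S} (hs : s ∉ G.sys) (x : Option A) :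
    (Sum.inl s, x) ∈ allowedSteps σ ↔ ∃ a ∈ G.act s, some a = x := by
  have hact : (G.hat R γ p hp).act (Sum.inl s) = some '' G.act s := if_neg hs
  constructor
  · intro h
    have := h.1
    rwa [hact] at this
  · intro h
    exact ⟨by rw [hact]; exact h, fun h => absurd (inl_mem_hat_sys_iff.1 h) hs⟩

theorem freeState_mem_allowedSteps_iff (s : G.sys) (x : Option A) :
    (G.freeState s, x) ∈ allowedSteps σ ↔ freeChoice σ s x ≠ 0 :=
  ⟨fun h => h.2 (G.freeState_mem s), fun h => ⟨exists_of_freeChoice_ne_zero σ h, fun _ => h⟩⟩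

theorem optState_mem_allowedSteps_iff (s : G.sys) (x : Option A) :
    (G.optState s, x) ∈ allowedSteps σ ↔ optChoice σ s x ≠ 0 :=
  ⟨fun h => h.2 (G.optState_mem s), fun h => ⟨exists_of_optChoice_ne_zero σ h, fun _ => h⟩⟩

theorem mem_allowedSteps_mixedStrategy_iff (hp0 : 0 < p) {s : S} (hs : s ∈ G.sys) (a : A) :
    (s, a) ∈ allowedSteps (mixedStrategy σ) ↔
      freeChoice σ ⟨s, hs⟩ (some a) ≠ 0 ∨ p < 1 ∧ optChoice σ ⟨s, hs⟩ (some a) ≠ 0 := by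
  rw [← choice_mixedStrategy_ne_zero_iff σ hp0 ⟨s, hs⟩ (mixedStrategy σ).init]
  exact ⟨fun h => h.2 hs, fun h => ⟨(mixedStrategy σ).choice_available ⟨s, hs⟩ _ h, fun _ => h⟩⟩

theorem mem_allowedSteps_iff_of_notMem {σ : G.SysStrategy} {s : S} (hs : s ∉ G.sys) (a : A) :
    (s, a) ∈ allowedSteps σ ↔ a ∈ G.act s :=
  ⟨fun h => h.1, fun h => ⟨h, fun h' => absurd h' hs⟩⟩

theorem Edge.mono {J K : Set (Step S A)} (h : J ⊆ K) {s t : S} (he : G.Edge J s t) :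
    G.Edge K s t := by
  obtain ⟨a, ha, hT⟩ := he
  exact ⟨a, h ha, hT⟩

/-! ### End components of the split game -/

/-- The steps of the split game over the steps in `J`. -/
def liftSteps (J : Set (Step S A)) : Set (Step G.HatState (Option A)) :=
  {x | x ∈ allowedSteps σ ∧ baseState x.1 ∈ statesOf J ∧
    (∀ s a, x = (Sum.inl s, some a) → ((s, a) : Step S A) ∈ J) ∧
    ∀ s, x.1 = G.optState s → p < 1}

section Lift

variable {J : Set (Step S A)}

theorem inl_none_mem_liftSteps {s : S} (hs : s ∈ G.sys) (hsJ : s ∈ statesOf J) :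
    ((Sum.inl s, none) : Step G.HatState (Option A)) ∈ liftSteps σ J :=
  ⟨(inl_mem_allowedSteps_iff_of_mem σ hs none).2 rfl, hsJ,
    fun _ _ h => (by cases congrArg Prod.snd h), fun _ h => by cases h⟩

theorem inl_some_mem_liftSteps {s : S} (hs : s ∉ G.sys) {a : A}
    (ha : a ∈ G.act s) (hsJ : ((s, a) : Step S A) ∈ J) :
    ((Sum.inl s, some a) : Step G.HatState (Option A)) ∈ liftSteps σ J := by
  refine ⟨(inl_mem_allowedSteps_iff_of_notMem σ hs _).2 ⟨a, ha, rfl⟩, ⟨a, hsJ⟩,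
    fun t b h => ?_, fun _ h => by cases h⟩
  cases h
  exact hsJ

theorem freeState_mem_liftSteps {s : G.sys} {x : Option A} (hx : freeChoice σ s x ≠ 0)
    (hs : (s : S) ∈ statesOf J) :
    ((G.freeState s, x) : Step G.HatState (Option A)) ∈ liftSteps σ J :=
  ⟨(freeState_mem_allowedSteps_iff σ s x).2 hx, hs,
    fun _ _ h => (by cases congrArg Prod.fst h), fun _ h => by cases h⟩

theorem optState_mem_liftSteps {s : G.sys} {x : Option A} (hx : optChoice σ s x ≠ 0)
    (hs : (s : S) ∈ statesOf J) (hp1 : p < 1) :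
    ((G.optState s, x) : Step G.HatState (Option A)) ∈ liftSteps σ J :=
  ⟨(optState_mem_allowedSteps_iff σ s x).2 hx, hs,
    fun _ _ h => (by cases congrArg Prod.fst h), fun _ _ => hp1⟩

theorem edge_inl_freeState (hp0 : 0 < p) {s : S} (hs : s ∈ G.sys) (hsJ : s ∈ statesOf J) :
    (G.hat R γ p hp).Edge (liftSteps σ J) (Sum.inl s) (G.freeState ⟨s, hs⟩) :=
  ⟨none, inl_none_mem_liftSteps σ hs hsJ, (hatT_inl_of_mem_ne_zero_iff hp0 hs _ _).2 (Or.inl rfl)⟩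

theorem edge_inl_optState (hp0 : 0 < p) (hp1 : p < 1) {s : S} (hs : s ∈ G.sys)
    (hsJ : s ∈ statesOf J) :
    (G.hat R γ p hp).Edge (liftSteps σ J) (Sum.inl s) (G.optState ⟨s, hs⟩) :=
  ⟨none, inl_none_mem_liftSteps σ hs hsJ,
    (hatT_inl_of_mem_ne_zero_iff hp0 hs _ _).2 (Or.inr ⟨hp1, rfl⟩)⟩

/-- An edge at a system state becomes two edges through a copy at which its action has positive
probability; an environment edge lifts to itself. -/
theorem reflTransGen_edge_inl (hp0 : 0 < p) (hJ : J ⊆ allowedSteps (mixedStrategy σ)) {s t : S}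
    (h : Relation.ReflTransGen (G.Edge J) s t) :
    Relation.ReflTransGen ((G.hat R γ p hp).Edge (liftSteps σ J)) (Sum.inl s) (Sum.inl t) := by
  refine Relation.ReflTransGen.lift' (p := (G.hat R γ p hp).Edge (liftSteps σ J)) Sum.inl
    ?_ s t h
  rintro s t ⟨a, ha, hT⟩
  by_cases hs : s ∈ G.sys
  · rcases (mem_allowedSteps_mixedStrategy_iff σ hp0 hs a).1 (hJ ha) with h | ⟨hp1, h⟩
    · exact (Relation.ReflTransGen.single (edge_inl_freeState σ hp0 hs ⟨a, ha⟩)).tail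
        ⟨some a, freeState_mem_liftSteps σ h ⟨a, ha⟩,
          (liftT_some_ne_zero_iff s a _).2 ⟨t, rfl, hT⟩⟩
    · exact (Relation.ReflTransGen.single (edge_inl_optState σ hp0 hp1 hs ⟨a, ha⟩)).tail
        ⟨some a, optState_mem_liftSteps σ h ⟨a, ha⟩ hp1,
          (liftT_some_ne_zero_iff s a _).2 ⟨t, rfl, hT⟩⟩
  · refine Relation.ReflTransGen.single
      ⟨some a, inl_some_mem_liftSteps σ hs (hJ ha).1 ha, ?_⟩
    rw [hatT_inl_of_notMem hs]
    exact (liftT_some_ne_zero_iff s a _).2 ⟨t, rfl, hT⟩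

theorem mem_statesOf_liftSteps (hJ : J ⊆ allowedSteps (mixedStrategy σ)) {s : S}
    (hs : s ∈ statesOf J) : (Sum.inl s : G.HatState) ∈ statesOf (liftSteps σ J) := by
  by_cases h : s ∈ G.sys
  · exact ⟨none, inl_none_mem_liftSteps σ h hs⟩
  · obtain ⟨a, ha⟩ := hs
    exact ⟨some a, inl_some_mem_liftSteps σ h (hJ ha).1 ha⟩

/-- A lifted step leaves an original system state, or it has the transition of a step in `J`. -/
theorem exists_of_mem_liftSteps (hp0 : 0 < p) (hJ : IsEndComponent (mixedStrategy σ) J)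
    {x : G.HatState} {o : Option A} (hx : ((x, o) : Step G.HatState (Option A)) ∈ liftSteps σ J) :
    (∃ s : G.sys, x = Sum.inl (s : S) ∧ (s : S) ∈ statesOf J) ∨
      ∃ a, ((baseState x, a) : Step S A) ∈ J ∧
        (G.hat R γ p hp).T x o = G.liftT (baseState x) (some a) := by
  obtain ⟨hal, ⟨b, hb⟩, hinl, hopt⟩ := hx
  rcases x with s | s | s
  · by_cases hs : s ∈ G.sys
    · exact Or.inl ⟨⟨s, hs⟩, rfl, b, hb⟩
    · obtain ⟨a, -, rfl⟩ := (inl_mem_allowedSteps_iff_of_notMem σ hs o).1 hal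
      exact Or.inr ⟨a, hinl s a rfl, hatT_inl_of_notMem hs _⟩
  · have h := (freeState_mem_allowedSteps_iff σ s o).1 hal
    obtain ⟨a, -, rfl⟩ := exists_of_freeChoice_ne_zero σ h
    exact Or.inr ⟨a, hJ.mem_of_sys s.2 hb
      ((mem_allowedSteps_mixedStrategy_iff σ hp0 s.2 a).2 (Or.inl h)), rfl⟩
  · have h := (optState_mem_allowedSteps_iff σ s o).1 hal
    obtain ⟨a, -, rfl⟩ := exists_of_optChoice_ne_zero σ h
    exact Or.inr ⟨a, hJ.mem_of_sys s.2 hb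
      ((mem_allowedSteps_mixedStrategy_iff σ hp0 s.2 a).2 (Or.inr ⟨hopt s rfl, h⟩)), rfl⟩

theorem isEndComponent_liftSteps (hp0 : 0 < p) (hJ : IsEndComponent (mixedStrategy σ) J) :
    IsEndComponent σ (liftSteps σ J) := by
  -- Connectivity reduces to `G`: every lifted state leads to an original one (`hto`) and is reached
  -- from its base state (`hfrom`), and paths of `J` lift in between.
  have hto : ∀ {x o}, ((x, o) : Step G.HatState (Option A)) ∈ liftSteps σ J →
      ∃ t ∈ statesOf J, Relation.ReflTransGen ((G.hat R γ p hp).Edge (liftSteps σ J)) x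
        (Sum.inl t) := by
    intro x o hx
    rcases exists_of_mem_liftSteps σ hp0 hJ hx with ⟨s, rfl, hs⟩ | ⟨a, ha, hT⟩
    · exact ⟨s, hs, Relation.ReflTransGen.refl⟩
    · obtain ⟨t, ht⟩ := (G.T (baseState x) a).support_nonempty
      refine ⟨t, hJ.closed ⟨a, ha, ht⟩, Relation.ReflTransGen.single ⟨o, hx, ?_⟩⟩
      rw [hT]
      exact (liftT_some_ne_zero_iff _ a _).2 ⟨t, rfl, ht⟩
  have hfrom : ∀ {x o}, ((x, o) : Step G.HatState (Option A)) ∈ liftSteps σ J →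
      Relation.ReflTransGen ((G.hat R γ p hp).Edge (liftSteps σ J)) (Sum.inl (baseState x)) x := by
    rintro (s | s | s) o ⟨-, hs, -, hopt⟩
    · exact Relation.ReflTransGen.refl
    · exact Relation.ReflTransGen.single (edge_inl_freeState σ hp0 s.2 hs)
    · exact Relation.ReflTransGen.single (edge_inl_optState σ hp0 (hopt s rfl) s.2 hs)
  refine ⟨?_, fun x hx => hx.1, ?_, ?_, ?_⟩
  · obtain ⟨x, hx⟩ := hJ.nonempty
    obtain ⟨o, ho⟩ := mem_statesOf_liftSteps σ hJ.subset_allowed (s := x.1) ⟨x.2, hx⟩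
    exact ⟨_, ho⟩
  · rintro x o o' hx ⟨-, h1, -, h3⟩ ho'
    refine ⟨ho', h1, ?_, h3⟩
    intro s a h
    have hxs : x = Sum.inl s := congrArg Prod.fst h
    -- At an original system state only `none` is allowed, so this case is contradictory.
    have hoa : o' = some a := congrArg Prod.snd h
    subst hxs hoa
    cases (inl_mem_allowedSteps_iff_of_mem σ (inl_mem_hat_sys_iff.1 hx) _).1 ho'
  · rintro x y ⟨o, ho, hT⟩
    rcases exists_of_mem_liftSteps σ hp0 hJ ho with ⟨s, rfl, hs⟩ | ⟨a, ha, hTa⟩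
    · rcases (hatT_inl_of_mem_ne_zero_iff hp0 s.2 o y).1 hT with rfl | ⟨hp1, rfl⟩
      · obtain ⟨o', ho'⟩ := (freeChoice σ s).support_nonempty
        exact ⟨o', freeState_mem_liftSteps σ ho' hs⟩
      · obtain ⟨o', ho'⟩ := (optChoice σ s).support_nonempty
        exact ⟨o', optState_mem_liftSteps σ ho' hs hp1⟩
    · rw [hTa] at hT
      obtain ⟨t, rfl, ht⟩ := (liftT_some_ne_zero_iff _ a y).1 hT
      exact mem_statesOf_liftSteps σ hJ.subset_allowed (hJ.closed ⟨a, ha, ht⟩)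
  · intro x o y o' hx hy
    obtain ⟨t, ⟨b, hb⟩, hxt⟩ := hto hx
    obtain ⟨c, hc⟩ := hy.2.1
    exact (hxt.trans (reflTransGen_edge_inl σ hp0 hJ.subset_allowed
      (hJ.connected hb hc))).trans (hfrom hy)

end Lift

/-! ### Projecting end components of the split game to `G` -/

/-- The steps of `G` below the steps in `K`. -/
def descendSteps (K : Set (Step G.HatState (Option A))) : Set (Step S A) :=
  {x | x ∈ allowedSteps (mixedStrategy σ) ∧ (x.1 ∈ G.sys → Sum.inl x.1 ∈ statesOf K) ∧
    (x.1 ∉ G.sys → ((Sum.inl x.1, some x.2) : Step G.HatState (Option A)) ∈ K)}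

section Descend

variable {K : Set (Step G.HatState (Option A))}

theorem inl_mem_statesOf_iff (hK : K ⊆ allowedSteps σ) {s : S} :
    (Sum.inl s : G.HatState) ∈ statesOf K ↔ s ∈ statesOf (descendSteps σ K) := by
  constructor
  · rintro ⟨o, ho⟩
    by_cases hs : s ∈ G.sys
    · obtain ⟨a, ha⟩ := ((mixedStrategy σ).choice ⟨s, hs⟩ (mixedStrategy σ).init).support_nonempty
      exact ⟨a, ⟨(mixedStrategy σ).choice_available ⟨s, hs⟩ _ ha, fun _ => ha⟩,
        fun _ => ⟨o, ho⟩, fun h => absurd hs h⟩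
    · obtain ⟨a, ha, rfl⟩ := (inl_mem_allowedSteps_iff_of_notMem σ hs o).1 (hK ho)
      exact ⟨a, (mem_allowedSteps_iff_of_notMem hs a).2 ha, fun h => absurd h hs, fun _ => ho⟩
  · rintro ⟨a, -, h1, h2⟩
    by_cases hs : s ∈ G.sys
    · exact h1 hs
    · exact ⟨some a, h2 hs⟩

/-- Entering a copy contracts to the empty path, and leaving it projects to an edge of `G`. The
closure conditions on `K` are weaker than being an end component, so that the statement also covers
reachability from an initial state. -/
theorem reflTransGen_edge_baseState (hp0 : 0 < p) (hK : K ⊆ allowedSteps σ)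
    (hfree : ∀ s, G.freeState s ∈ statesOf K → Sum.inl (s : S) ∈ statesOf K)
    (hopt : ∀ s, G.optState s ∈ statesOf K → p < 1 ∧ Sum.inl (s : S) ∈ statesOf K)
    {x y : G.HatState} (h : Relation.ReflTransGen ((G.hat R γ p hp).Edge K) x y) :
    Relation.ReflTransGen (G.Edge (descendSteps σ K)) (baseState x) (baseState y) := by
  refine Relation.ReflTransGen.lift' (p := G.Edge (descendSteps σ K)) baseState ?_ x y h
  rintro x y ⟨o, ho, hT⟩
  rcases x with s | s | s
  · by_cases hs : s ∈ G.sys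
    · rcases (hatT_inl_of_mem_ne_zero_iff hp0 hs o y).1 hT with rfl | ⟨-, rfl⟩ <;>
        exact Relation.ReflTransGen.refl
    · obtain ⟨a, ha, rfl⟩ := (inl_mem_allowedSteps_iff_of_notMem σ hs o).1 (hK ho)
      rw [hatT_inl_of_notMem hs] at hT
      obtain ⟨t, rfl, ht⟩ := (liftT_some_ne_zero_iff s a y).1 hT
      exact Relation.ReflTransGen.single ⟨a, ⟨(mem_allowedSteps_iff_of_notMem hs a).2 ha,
        fun h => absurd h hs, fun _ => ho⟩, ht⟩
  · have h := (freeState_mem_allowedSteps_iff σ s o).1 (hK ho)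
    obtain ⟨a, -, rfl⟩ := exists_of_freeChoice_ne_zero σ h
    obtain ⟨t, rfl, ht⟩ := (liftT_some_ne_zero_iff (s : S) a y).1 hT
    exact Relation.ReflTransGen.single ⟨a,
      ⟨(mem_allowedSteps_mixedStrategy_iff σ hp0 s.2 a).2 (Or.inl h),
        fun _ => hfree s ⟨_, ho⟩, fun h => absurd s.2 h⟩, ht⟩
  · have h := (optState_mem_allowedSteps_iff σ s o).1 (hK ho)
    obtain ⟨a, -, rfl⟩ := exists_of_optChoice_ne_zero σ h
    obtain ⟨t, rfl, ht⟩ := (liftT_some_ne_zero_iff (s : S) a y).1 hT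
    exact Relation.ReflTransGen.single ⟨a,
      ⟨(mem_allowedSteps_mixedStrategy_iff σ hp0 s.2 a).2 (Or.inr ⟨(hopt s ⟨_, ho⟩).1, h⟩),
        fun _ => (hopt s ⟨_, ho⟩).2, fun h => absurd s.2 h⟩, ht⟩

/-- A copy of a system state is only entered from that state. -/
theorem eq_inl_of_edge (hp0 : 0 < p) (hK : K ⊆ allowedSteps σ) {x : G.HatState} {c : G.sys ⊕ G.sys}
    (h : (G.hat R γ p hp).Edge K x (Sum.inr c)) :
    x = Sum.inl (baseState (Sum.inr c : G.HatState)) ∧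
      ∀ s, (Sum.inr c : G.HatState) = G.optState s → p < 1 := by
  obtain ⟨o, ho, hT⟩ := h
  rcases x with s | s | s
  · by_cases hs : s ∈ G.sys
    · rcases (hatT_inl_of_mem_ne_zero_iff hp0 hs o _).1 hT with h | ⟨hp1, h⟩
      · cases h
        exact ⟨rfl, fun _ h => by cases h⟩
      · cases h
        exact ⟨rfl, fun _ _ => hp1⟩
    · obtain ⟨a, ha, rfl⟩ := (inl_mem_allowedSteps_iff_of_notMem σ hs o).1 (hK ho)
      rw [hatT_inl_of_notMem hs] at hT
      obtain ⟨t, ht, -⟩ := (liftT_some_ne_zero_iff s a _).1 hT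
      cases ht
  · obtain ⟨a, -, rfl⟩ :=
      exists_of_freeChoice_ne_zero σ ((freeState_mem_allowedSteps_iff σ s o).1 (hK ho))
    obtain ⟨t, ht, -⟩ := (liftT_some_ne_zero_iff (s : S) a _).1 hT
    cases ht
  · obtain ⟨a, -, rfl⟩ :=
      exists_of_optChoice_ne_zero σ ((optState_mem_allowedSteps_iff σ s o).1 (hK ho))
    obtain ⟨t, ht, -⟩ := (liftT_some_ne_zero_iff (s : S) a _).1 hT
    cases ht

/-- States of an end component have predecessors in it, and the only possible predecessor of a copy
is its original. This also excludes optimal copies when p = 1. -/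
theorem IsEndComponent.of_copy_mem (hp0 : 0 < p) (hK : IsEndComponent σ K) {c : G.sys ⊕ G.sys}
    (hc : (Sum.inr c : G.HatState) ∈ statesOf K) :
    (Sum.inl (baseState (Sum.inr c : G.HatState)) : G.HatState) ∈ statesOf K ∧
      ∀ s, (Sum.inr c : G.HatState) = G.optState s → p < 1 := by
  obtain ⟨x, hx⟩ := hK.exists_edge hc
  obtain ⟨h1, h2⟩ := eq_inl_of_edge σ hp0 hK.subset_allowed hx
  obtain ⟨o, ho, -⟩ := hx
  exact ⟨⟨o, h1 ▸ ho⟩, h2⟩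

theorem isEndComponent_descendSteps (hp0 : 0 < p) (hK : IsEndComponent σ K) :
    IsEndComponent (mixedStrategy σ) (descendSteps σ K) := by
  refine ⟨?_, fun x hx => hx.1, ?_, ?_, ?_⟩
  · obtain ⟨⟨x, o⟩, ho⟩ := hK.nonempty
    have hx : (Sum.inl (baseState x) : G.HatState) ∈ statesOf K := by
      rcases x with s | c
      · exact ⟨o, ho⟩
      · exact (hK.of_copy_mem σ hp0 ⟨o, ho⟩).1
    obtain ⟨a, ha⟩ := (inl_mem_statesOf_iff σ hK.subset_allowed).1 hx
    exact ⟨_, ha⟩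
  · rintro s a b hs ⟨-, h1, -⟩ hb
    exact ⟨hb, h1, fun h => absurd hs h⟩
  · rintro s t ⟨a, ⟨ha, h1, h2⟩, hT⟩
    refine (inl_mem_statesOf_iff σ hK.subset_allowed).1 ?_
    by_cases hs : s ∈ G.sys
    · obtain ⟨o, ho⟩ := h1 hs
      rcases (mem_allowedSteps_mixedStrategy_iff σ hp0 hs a).1 ha with h | ⟨hp1, h⟩
      · obtain ⟨o', ho'⟩ := hK.closed ⟨o, ho, (hatT_inl_of_mem_ne_zero_iff hp0 hs _ _).2
          (Or.inl rfl)⟩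
        exact hK.closed ⟨some a, hK.mem_of_sys (G.freeState_mem _) ho'
          ((freeState_mem_allowedSteps_iff σ ⟨s, hs⟩ _).2 h),
          (liftT_some_ne_zero_iff s a _).2 ⟨t, rfl, hT⟩⟩
      · obtain ⟨o', ho'⟩ := hK.closed ⟨o, ho, (hatT_inl_of_mem_ne_zero_iff hp0 hs _ _).2
          (Or.inr ⟨hp1, rfl⟩)⟩
        exact hK.closed ⟨some a, hK.mem_of_sys (G.optState_mem _) ho'
          ((optState_mem_allowedSteps_iff σ ⟨s, hs⟩ _).2 h),
          (liftT_some_ne_zero_iff s a _).2 ⟨t, rfl, hT⟩⟩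
    · refine hK.closed ⟨some a, h2 hs, ?_⟩
      rw [hatT_inl_of_notMem hs]
      exact (liftT_some_ne_zero_iff s a _).2 ⟨t, rfl, hT⟩
  · intro s a t b hs ht
    obtain ⟨o, ho⟩ := (inl_mem_statesOf_iff σ hK.subset_allowed).2 ⟨a, hs⟩
    obtain ⟨o', ho'⟩ := (inl_mem_statesOf_iff σ hK.subset_allowed).2 ⟨b, ht⟩
    exact reflTransGen_edge_baseState σ hp0 hK.subset_allowed
      (fun s h => (hK.of_copy_mem σ hp0 h).1)
      (fun s h => ⟨(hK.of_copy_mem σ hp0 h).2 s rfl, (hK.of_copy_mem σ hp0 h).1⟩)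
      (hK.connected ho ho')

theorem reflTransGen_edge_baseState_of_inl (hp0 : 0 < p) {s₀ : S} {y : G.HatState}
    (h : Relation.ReflTransGen ((G.hat R γ p hp).Edge (allowedSteps σ)) (Sum.inl s₀) y) :
    Relation.ReflTransGen (G.Edge (allowedSteps (mixedStrategy σ))) s₀ (baseState y) := by
  -- Steps at optimal copies are discarded when p = 1. Nothing is lost on paths starting at an
  -- original state, since no edge then enters such a copy.
  let K : Set (Step G.HatState (Option A)) :=
    {x | x ∈ allowedSteps σ ∧ ∀ s, x.1 = G.optState s → p < 1}
  have hK : K ⊆ allowedSteps σ := fun x hx => hx.1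
  have hinl : ∀ s : G.sys, (Sum.inl (s : S) : G.HatState) ∈ statesOf K := fun s =>
    ⟨none, (inl_mem_allowedSteps_iff_of_mem σ s.2 none).2 rfl, fun _ h => by cases h⟩
  have key : Relation.ReflTransGen ((G.hat R γ p hp).Edge K) (Sum.inl s₀) y ∧
      ∀ s, y = G.optState s → p < 1 := by
    induction h with
    | refl => exact ⟨Relation.ReflTransGen.refl, fun _ h => by cases h⟩
    | @tail x y _ he ih =>
      refine ⟨ih.1.tail ?_, ?_⟩
      · obtain ⟨o, ho, hT⟩ := he
        exact ⟨o, ⟨ho, ih.2⟩, hT⟩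
      · rcases y with t | c
        · exact fun _ h => by cases h
        · exact (eq_inl_of_edge σ hp0 subset_rfl he).2
  exact Relation.ReflTransGen.mono (fun _ _ => Edge.mono fun x hx => hx.1) _ _
    (reflTransGen_edge_baseState σ hp0 hK (fun s _ => hinl s)
      (fun s ⟨o, ho⟩ => ⟨ho.2 s rfl, hinl s⟩) key.1)

end Descend

/-! ### Transfer of the winning condition -/

theorem rabinSet_hat_iff {U : Set G.HatState} {V : Set S} (h : ∀ s, Sum.inl s ∈ U ↔ s ∈ V) :
    (G.hat R γ p hp).RabinSet U ↔ G.RabinSet V := by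
  have key : ∀ W : Set S, U ∩ Sum.inl '' W = Sum.inl '' (V ∩ W) := by
    intro W
    ext x
    constructor
    · rintro ⟨hU, s, hs, rfl⟩
      exact ⟨s, ⟨(h s).1 hU, hs⟩, rfl⟩
    · rintro ⟨s, ⟨hV, hs⟩, rfl⟩
      exact ⟨(h s).2 hV, s, hs, rfl⟩
  change (∃ i : Fin G.d, (U ∩ Sum.inl '' G.F i).Nonempty ∧ U ∩ Sum.inl '' G.E i = ∅) ↔ _
  simp only [key, Set.image_nonempty, Set.image_eq_empty]
  rfl

theorem almostSureWinning_hat_iff (hp0 : 0 < p) (hσ : ∀ m, m = σ.init) :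
    (G.hat R γ p hp).AlmostSureWinning σ ↔ G.AlmostSureWinning (mixedStrategy σ) := by
  rw [← not_iff_not, not_almostSureWinning_iff hσ, not_almostSureWinning_iff fun _ => rfl]
  constructor
  · rintro ⟨_, ⟨s₀, hs₀, rfl⟩, K, hK, ⟨y, ⟨o, ho⟩, hy⟩, hR⟩
    refine ⟨s₀, hs₀, descendSteps σ K, isEndComponent_descendSteps σ hp0 hK,
      ⟨baseState y, (inl_mem_statesOf_iff σ hK.subset_allowed).1 ?_,
        reflTransGen_edge_baseState_of_inl σ hp0 hy⟩, ?_⟩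
    · rcases y with s | c
      · exact ⟨o, ho⟩
      · exact (hK.of_copy_mem σ hp0 ⟨o, ho⟩).1
    · rwa [← rabinSet_hat_iff (R := R) (γ := γ) (hp := hp) (U := statesOf K)
        fun s => inl_mem_statesOf_iff σ hK.subset_allowed]
  · rintro ⟨s₀, hs₀, J, hJ, ⟨s, hs, hreach⟩, hR⟩
    refine ⟨Sum.inl s₀, ⟨s₀, hs₀, rfl⟩, liftSteps σ J, isEndComponent_liftSteps σ hp0 hJ,
      ⟨Sum.inl s, mem_statesOf_liftSteps σ hJ.subset_allowed hs,
        Relation.ReflTransGen.mono (fun _ _ => Edge.mono fun x hx => hx.1) _ _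
          (reflTransGen_edge_inl σ hp0 subset_rfl hreach)⟩, ?_⟩
    rwa [rabinSet_hat_iff (V := statesOf J)]
    exact fun s => ⟨fun ⟨o, ho⟩ => ho.2.1, mem_statesOf_liftSteps σ hJ.subset_allowed⟩

end Hat

end RabinGame

/-- The defining equation of the branching probability. -/
theorem branchProb_mul_div {Rmax γ ε : ℝ} (hγ1 : γ < 1) (hε : 0 < ε)
    (hεR : ε * (1 - γ) ≤ Rmax) :
    branchProb Rmax γ ε * (Rmax / (1 - γ)) = ε * (1 - γ + branchProb Rmax γ ε * γ) := by
  have h1 : 0 < 1 - γ := sub_pos.2 hγ1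
  have hd : Rmax - ε * (1 - γ) * γ ≠ 0 := by
    have : ε * (1 - γ) * γ < ε * (1 - γ) := mul_lt_of_lt_one_right (mul_pos hε h1) hγ1
    linarith
  have hb : branchProb Rmax γ ε * (Rmax - ε * (1 - γ) * γ) = (1 - γ) ^ 2 * ε :=
    div_mul_cancel₀ _ hd
  rw [← mul_div_assoc, div_eq_iff h1.ne']
  linear_combination hb

end

open Classical in
theorem lemma7 {S A : Type*} [Finite S] [Finite A] (G : RabinGame S A)
    (R : S → A → S → ℝ) (Rmax γ ε : ℝ)
    (hR0 : ∀ s a s', 0 ≤ R s a s') (hRmax : ∀ s a s', R s a s' ≤ Rmax)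
    (hγ0 : 0 < γ) (hγ1 : γ < 1) (hε : 0 < ε) (hεR : ε * (1 - γ) ≤ Rmax)
    (σhat : (G.hat R γ (branchProb Rmax γ ε) (branchProb_mem hγ1 hε hεR)).SysStrategy)
    (hσhat : σhat.Memoryless) :
    ∃ σ : G.SysStrategy, σ.Memoryless ∧
      (∀ s : G.sys, ∀ a ∈ G.act s,
        (σ.choice s σ.init a).toReal =
          if a ∈ G.optAct R γ s then
            branchProb Rmax γ ε *
                (σhat.choice ⟨G.freeState s, G.freeState_mem s⟩ σhat.init (some a)).toReal +
              (1 - branchProb Rmax γ ε) *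
                (σhat.choice ⟨G.optState s, G.optState_mem s⟩ σhat.init (some a)).toReal
          else
            branchProb Rmax γ ε *
              (σhat.choice ⟨G.freeState s, G.freeState_mem s⟩ σhat.init (some a)).toReal) ∧
      G.EpsOptimal R γ ε σ ∧
      ((G.hat R γ (branchProb Rmax γ ε)
          (branchProb_mem hγ1 hε hεR)).AlmostSureWinning σhat ↔
        G.AlmostSureWinning σ) := by
  have hp := branchProb_mem hγ1 hε hεR
  obtain ⟨m, hm⟩ := hσhat
  refine ⟨RabinGame.mixedStrategy σhat, ⟨(), fun _ => rfl⟩, fun s a _ => ?_, ?_, ?_⟩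
  · rw [RabinGame.toReal_choice_mixedStrategy]
    split_ifs with ha
    · rfl
    -- A non-optimal action is unavailable at the optimal copy, so both cases of the formula are the
    -- same mixture.
    · have h0 : RabinGame.optChoice σhat s (some a) = 0 := by
        by_contra h
        obtain ⟨b, hb, hba⟩ := RabinGame.exists_of_optChoice_ne_zero σhat h
        exact ha (Option.some_injective _ hba ▸ hb)
      rw [h0, ENNReal.toReal_zero, mul_zero, add_zero]
      rfl
  · exact RabinGame.epsOptimal_of_mixture hγ0.le hγ1 hR0 hRmax hp
      (branchProb_mul_div hγ1 hε hεR).le _ fun s m =>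
        ⟨_, _, RabinGame.support_copyChoice_false σhat s,
          RabinGame.expect_choice_mixedStrategy σhat s m⟩
  · exact RabinGame.almostSureWinning_hat_iff σhat ((branchProb_mem_Ioc_iff hγ1 hε).2 hεR).1
      fun m' => (hm m').trans (hm _).symm
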